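/- A database graph $G$ consists of a finite set $I$ of items, a finite directed graph $(V,E)$, and for each vertex $v$ a finite set $\mathcal T_v$ of transactions $T=(tid,X)$ with $X\subseteq I$ (an itemset) and $tid$ an identifier that determines the transaction. Let $D_l$ be the set of all sequences $\langle T_1,\dots,T_{l+1}\rangle$ of transactions for which there is a simple directed path $v_1,\dots,v_{l+1}$ in $G$ with $T_i\in\mathcal T_{v_i}$. A pattern of length $l$ is a sequence $s=\langle X_1,\dots,X_{l+1}\rangle$ of itemsets; its frequency $f(s)$ is the proportion of sequences in $D_l$ with $X_i\subseteq T_i$ for all $i$ (and $f(s)=0$ if $D_l=\emptyset$). Fix $l>0$. Problem TSPMG: given $G$ and an integer $k>0$, list $k$ patterns of length $l$ with the largest frequencies, in order of non-increasing frequency, ties broken arbitrarily (all patterns if there are fewer than $k$). Problem SPCG: given $G$ and a rational threshold $\alpha>0$, count the patterns of length $l$ with frequency larger than $\alpha$. Theorem. TSPMG is at least as hard as SPCG: for every fixed $l>0$ there is a polynomial-time Cook (oracle) reduction from SPCG to TSPMG. That is, there is an oracle program, depending only on $l$ (and on the convention on empty itemsets below), which with every oracle that solves TSPMG solves every instance of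 SPCG in time polynomial in the size of the instance, measured by bit cost. (The oracle's answer is a possibly exponentially long list; the program may read any single entry of the last answer by its index, and pays for the questions it asks, the indices it uses and the entries it reads.) The number of accesses to the oracle (questions asked and entries read) is $\mathcal O(|I|(l+1)+1)$, with an absolute constant. Moreover the answer to SPCG is at most $2^{|I|(l+1)}$, and if $s_1,s_2,\dots,s_N$ are all the patterns of length $l$ in order of non-increasing frequency, it is the unique $k\in\{0,\dots,N\}$ with $f(s_k)>\alpha\ge f(s_{k+1})$, where the first inequality is void for $k=0$ and the second for $k=N$. All this holds both if the itemsets of a pattern may be empty and if they are required to be nonempty. -/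

import Mathlib

/-! ## Database graphs, sequential patterns and frequencies -/

/-- A transaction `(tid, X)`: a transaction id and an itemset over the items `0, …, m - 1`. -/
abbrev Transaction (m : ℕ) : Type := ℕ × Finset (Fin m)

/-- A (finite) database graph, with the items `0, …, numItems - 1` and the vertices
`0, …, numVertices - 1`. The transaction database of a vertex is a finite set of transactions,
presented as a list without repetitions. -/
structure DBGraph where
  numItems : ℕ
  numVertices : ℕ
  edges : Finset (Fin numVertices × Fin numVertices)
  db : Fin numVertices → List (Transaction numItems)
  nodup : ∀ v, (db v).Nodup
  tid_unique : ∀ v w, ∀ T ∈ db v, ∀ T' ∈ db w, T.1 = T'.1 → T = T'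

namespace DBGraph

/-- The simple directed paths with `l` edges, given by their `l + 1` vertices. -/
def paths (G : DBGraph) (l : ℕ) : Finset (Fin (l + 1) → Fin G.numVertices) :=
  Finset.univ.filter fun p =>
    Function.Injective p ∧ ∀ i : Fin l, (p i.castSucc, p i.succ) ∈ G.edges

/-- `D_l`: the set of all length-`l` transaction sequences supported by paths. -/
def transSeqs (G : DBGraph) (l : ℕ) : Finset (Fin (l + 1) → Transaction G.numItems) :=
  (G.paths l).biUnion fun p => Fintype.piFinset fun i => (G.db (p i)).toFinset

/-- Sequential patterns of length `l`: sequences of `l + 1` itemsets. -/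
abbrev Pattern (G : DBGraph) (l : ℕ) : Type := Fin (l + 1) → Finset (Fin G.numItems)

/-- A transaction sequence contains a pattern. -/
def Contains {G : DBGraph} {l : ℕ} (ts : Fin (l + 1) → Transaction G.numItems)
    (s : G.Pattern l) : Prop :=
  ∀ i, s i ⊆ (ts i).2

instance {G : DBGraph} {l : ℕ} (ts : Fin (l + 1) → Transaction G.numItems)
    (s : G.Pattern l) : Decidable (Contains ts s) :=
  inferInstanceAs (Decidable (∀ i, s i ⊆ (ts i).2))

/-- The frequency of `s`: the proportion of the transaction sequences in `D_l` that contain `s`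
(it is `0` if `D_l` is empty). -/
def freq (G : DBGraph) {l : ℕ} (s : G.Pattern l) : ℚ :=
  (((G.transSeqs l).filter fun ts => Contains ts s).card : ℚ) / ((G.transSeqs l).card : ℚ)

/-- The length-`l` patterns that are considered. The flag selects the convention on the empty
itemset: with `allowEmpty = true` the itemsets of a pattern are arbitrary sets of items, with
`allowEmpty = false` they are nonempty sets of items. -/
def patterns (G : DBGraph) (allowEmpty : Bool) (l : ℕ) : Finset (G.Pattern l) :=
  Finset.univ.filter fun s => allowEmpty = true ∨ ∀ i, (s i).Nonempty

/-- `L` lists top-`k` patterns of length `l`, most frequent first, ties broken arbitrarily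
(all the patterns, if there are fewer than `k`). -/
structure IsTopK (G : DBGraph) (allowEmpty : Bool) (l k : ℕ) (L : List (G.Pattern l)) : Prop where
  nodup : L.Nodup
  subset : ∀ s ∈ L, s ∈ G.patterns allowEmpty l
  length_eq : L.length = min k (G.patterns allowEmpty l).card
  sorted : L.Pairwise fun s t => G.freq t ≤ G.freq s
  top : ∀ s ∈ L, ∀ t ∈ G.patterns allowEmpty l, t ∉ L → G.freq t ≤ G.freq s

/-- The number of length-`l` patterns with frequency larger than `α`. -/
def patternCount (G : DBGraph) (allowEmpty : Bool) (l : ℕ) (α : ℚ) : ℕ :=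
  ((G.patterns allowEmpty l).filter fun s => α < G.freq s).card

end DBGraph

/-! ## Oracle programs with a step count

Programs of a while-language whose data are binary trees with natural numbers, written in binary,
at the leaves. Every operation is charged the bit size of its operands and of its result, so that
polynomial time is polynomial time in the usual sense. -/

/-- Data. -/
inductive Val : Type
  | nat (n : ℕ) : Val
  | pair (a b : Val) : Val
  deriving DecidableEq

namespace Val

/-- The size of a datum: one per node, plus the number of binary digits of each leaf. -/
def size : Val → ℕ
  | nat n => n.size + 1
  | pair a b => a.size + b.size + 1

/-- The number at a leaf, `0` at a pair. -/
def toNat : Val → ℕ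
  | nat n => n
  | pair _ _ => 0

/-- First component, `0` at a leaf. -/
def fst : Val → Val
  | nat _ => nat 0
  | pair a _ => a

/-- Second component, `0` at a leaf. -/
def snd : Val → Val
  | nat _ => nat 0
  | pair _ b => b

/-- Truth values. -/
def ofBool (b : Bool) : Val := nat (if b then 1 else 0)

/-- Lists as data: `0` is the empty list, `pair a b` has head `a` and tail `b`. -/
def ofList : List Val → Val
  | [] => nat 0
  | a :: L => pair a (ofList L)

end Val

/-- Expressions over the program variables, which are numbered. -/
inductive Expr : Type
  | var (x : ℕ) : Expr
  | const (n : ℕ) : Expr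
  | pair (a b : Expr) : Expr
  | fst (a : Expr) : Expr
  | snd (a : Expr) : Expr
  | eq (a b : Expr) : Expr
  | lt (a b : Expr) : Expr
  | add (a b : Expr) : Expr
  | sub (a b : Expr) : Expr
  | mul (a b : Expr) : Expr
  | div (a b : Expr) : Expr

namespace Expr

/-- The value of an expression under an assignment of data to the variables. -/
def eval (ρ : ℕ → Val) : Expr → Val
  | var x => ρ x
  | const n => .nat n
  | pair a b => .pair (a.eval ρ) (b.eval ρ)
  | fst a => (a.eval ρ).fst
  | snd a => (a.eval ρ).snd
  | eq a b => .ofBool (decide (a.eval ρ = b.eval ρ))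
  | lt a b => .ofBool (decide ((a.eval ρ).toNat < (b.eval ρ).toNat))
  | add a b => .nat ((a.eval ρ).toNat + (b.eval ρ).toNat)
  | sub a b => .nat ((a.eval ρ).toNat - (b.eval ρ).toNat)
  | mul a b => .nat ((a.eval ρ).toNat * (b.eval ρ).toNat)
  | div a b => .nat ((a.eval ρ).toNat / (b.eval ρ).toNat)

/-- The cost of evaluating an expression: the total size of the values of all its
subexpressions. -/
def cost (ρ : ℕ → Val) : Expr → ℕ
  | var x => (ρ x).size
  | const n => (Val.nat n).size
  | pair a b => a.cost ρ + b.cost ρ + (eval ρ (pair a b)).size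
  | fst a => a.cost ρ + (eval ρ (fst a)).size
  | snd a => a.cost ρ + (eval ρ (snd a)).size
  | eq a b => a.cost ρ + b.cost ρ + (eval ρ (eq a b)).size
  | lt a b => a.cost ρ + b.cost ρ + (eval ρ (lt a b)).size
  | add a b => a.cost ρ + b.cost ρ + (eval ρ (add a b)).size
  | sub a b => a.cost ρ + b.cost ρ + (eval ρ (sub a b)).size
  | mul a b => a.cost ρ + b.cost ρ + (eval ρ (mul a b)).size
  | div a b => a.cost ρ + b.cost ρ + (eval ρ (div a b)).size

end Expr

/-- Commands. `query a` puts the question `a` to the oracle; `read x a` reads the entry with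
index `a` (counted from `0`) of the oracle's last answer into the variable `x`. -/
inductive Cmd : Type
  | skip : Cmd
  | assign (x : ℕ) (a : Expr) : Cmd
  | seq (c d : Cmd) : Cmd
  | ite (a : Expr) (c d : Cmd) : Cmd
  | loop (a : Expr) (c : Cmd) : Cmd
  | query (a : Expr) : Cmd
  | read (x : ℕ) (a : Expr) : Cmd

/-- A state: the values of the variables, and the last answer of the oracle. -/
structure OState where
  vars : ℕ → Val
  answer : List Val

/-- The initial state: the input in variable `0`, nothing anywhere else. -/
def OState.init (input : Val) : OState :=
  ⟨Function.update (fun _ => Val.nat 0) 0 input, []⟩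

/-- `Exec O c σ σ' t q`: with the oracle `O`, the command `c` started in `σ` halts in `σ'` after
`t` steps, of which `q` are accesses to the oracle (questions asked or entries read). The answer
to a question is a list; it may be long, but only the question and the entries that are read, with
their indices, are paid for. Reading beyond the end of the answer gives `0`. -/
inductive Exec (O : Val → List Val) : Cmd → OState → OState → ℕ → ℕ → Prop
  | skip (σ : OState) : Exec O .skip σ σ 1 0
  | assign (x : ℕ) (a : Expr) (σ : OState) :
      Exec O (.assign x a) σ ⟨Function.update σ.vars x (a.eval σ.vars), σ.answer⟩
        (a.cost σ.vars + 1) 0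
  | seq {c d : Cmd} {σ σ₁ σ₂ : OState} {t t' q q' : ℕ} :
      Exec O c σ σ₁ t q → Exec O d σ₁ σ₂ t' q' →
      Exec O (.seq c d) σ σ₂ (t + t' + 1) (q + q')
  | ite_true {a : Expr} {c d : Cmd} {σ σ₁ : OState} {t q : ℕ} :
      a.eval σ.vars ≠ .nat 0 → Exec O c σ σ₁ t q →
      Exec O (.ite a c d) σ σ₁ (a.cost σ.vars + t + 1) q
  | ite_false {a : Expr} {c d : Cmd} {σ σ₁ : OState} {t q : ℕ} :
      a.eval σ.vars = .nat 0 → Exec O d σ σ₁ t q →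
      Exec O (.ite a c d) σ σ₁ (a.cost σ.vars + t + 1) q
  | loop_true {a : Expr} {c : Cmd} {σ σ₁ σ₂ : OState} {t t' q q' : ℕ} :
      a.eval σ.vars ≠ .nat 0 → Exec O c σ σ₁ t q → Exec O (.loop a c) σ₁ σ₂ t' q' →
      Exec O (.loop a c) σ σ₂ (a.cost σ.vars + t + t' + 1) (q + q')
  | loop_false {a : Expr} {c : Cmd} {σ : OState} :
      a.eval σ.vars = .nat 0 → Exec O (.loop a c) σ σ (a.cost σ.vars + 1) 0
  | query (a : Expr) (σ : OState) :
      Exec O (.query a) σ ⟨σ.vars, O (a.eval σ.vars)⟩ (a.cost σ.vars + 1) 1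
  | read (x : ℕ) (a : Expr) (σ : OState) :
      Exec O (.read x a) σ
        ⟨Function.update σ.vars x (σ.answer.getD (a.eval σ.vars).toNat (.nat 0)), σ.answer⟩
        (a.cost σ.vars + (σ.answer.getD (a.eval σ.vars).toNat (.nat 0)).size + 1) 1

/-! ## Computational problems and Cook reductions -/

/-- A computational (function or search) problem: instances, their encoding, and the correct
answers to each instance. -/
structure Problem where
  Instance : Type
  code : Instance → Val
  Answer : Instance → List Val → Prop

/-- The oracle `O` answers every instance of the problem correctly. -/
def Problem.Solves (B : Problem) (O : Val → List Val) : Prop :=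
  ∀ x : B.Instance, B.Answer x (O (B.code x))

/-- `A` is Cook reducible to `B` in polynomial time, with at most `b x` accesses to the oracle on
the instance `x`: one oracle program solves `A` in polynomial time with every oracle for `B`.
The output is the final value of variable `0`. -/
def CookReducible (A B : Problem) (b : A.Instance → ℕ) : Prop :=
  ∃ (c : Cmd) (p : Polynomial ℕ), ∀ O : Val → List Val, B.Solves O → ∀ x : A.Instance,
    ∃ (σ : OState) (t q : ℕ) (ans : List Val),
      Exec O c (OState.init (A.code x)) σ t q ∧
      t ≤ p.eval (A.code x).size ∧ q ≤ b x ∧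
      A.Answer x ans ∧ σ.vars 0 = Val.ofList ans

/-! ## Encodings and the two problems -/

/-- A set of items as the list of its `m` membership bits. -/
def codeItemset {m : ℕ} (X : Finset (Fin m)) : Val :=
  .ofList ((List.finRange m).map fun i => .ofBool (decide (i ∈ X)))

/-- A transaction. -/
def codeTransaction {m : ℕ} (T : Transaction m) : Val :=
  .pair (.nat T.1) (codeItemset T.2)

/-- A pattern, as the list of its itemsets. -/
def codePattern {G : DBGraph} {l : ℕ} (s : G.Pattern l) : Val :=
  .ofList ((List.finRange (l + 1)).map fun i => codeItemset (s i))

/-- A database graph: the list of its items, and for each vertex its row of the adjacency matrix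
and its transaction database. -/
def codeGraph (G : DBGraph) : Val :=
  .pair
    (.ofList ((List.finRange G.numItems).map fun i => .nat i))
    (.ofList ((List.finRange G.numVertices).map fun v =>
      .pair
        (.ofList ((List.finRange G.numVertices).map fun w => .ofBool (decide ((v, w) ∈ G.edges))))
        (.ofList ((G.db v).map codeTransaction))))

/-- Top-`k` sequential pattern mining in graphs, for the fixed length `l`: given a database graph
and an integer `k > 0`, list top-`k` patterns of length `l`. -/
def TSPMG (allowEmpty : Bool) (l : ℕ) : Problem where
  Instance := DBGraph × {k : ℕ // 0 < k}
  code x := .pair (codeGraph x.1) (.nat x.2)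
  Answer x ans := ∃ L : List (x.1.Pattern l),
    x.1.IsTopK allowEmpty l x.2 L ∧ ans = L.map codePattern

/-- Sequential pattern counting in graphs, for the fixed length `l`: given a database graph and a
(rational) threshold `α > 0`, count the patterns of length `l` with frequency larger than `α`. -/
def SPCG (allowEmpty : Bool) (l : ℕ) : Problem where
  Instance := DBGraph × {α : ℚ // 0 < α}
  code x := .pair (codeGraph x.1) (.pair (.nat (x.2 : ℚ).num.toNat) (.nat (x.2 : ℚ).den))
  Answer x ans := ans = [.nat (x.1.patternCount allowEmpty l x.2)]

/-!
The reduction asks the oracle a single question, for the `2 ^ N` most frequent patterns, where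
`N = |I| (l + 1)`. There are at most `2 ^ N` patterns, so the answer lists all of them by
non-increasing frequency, and the patterns above the threshold form an initial segment of it
(`DBGraph.IsTopK.lt_patternCount_iff`), whose length is the pattern count. That length is found by a
binary search with `N + 1` reads (`exec_search`). This also gives the bound `2 ^ N` and the
characterization of the count in the theorem.

After each read the program must decide whether the frequency of the pattern exceeds the threshold.
As `l` is fixed, this takes polynomial time: the sequences of `l + 1` distinct vertices, together with
a transaction at each of them, are polynomially many, so that `D_l` can be listed (`codeSeqs`, where
repetitions are removed, since one sequence may be supported by several paths), and the sequences
that contain the pattern can be counted (`codeExceeds`, `codeExceeds_patternCode`).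

To obtain programs and time bounds without writing the programs out, `PolyTime f` says that a
function `f` between encoded types is computed by commands that work in an arbitrary variable, use
only the variables above it as scratch space, and take polynomial time. This notion is closed under
composition, pairing, case distinction and folds whose accumulators remain of polynomial size
(`PolyTime.foldl`), hence under the usual operations on lists, of which the test is composed.
-/

/-! ### Encoded types and polynomial-time functions -/

/-- A type whose elements are encoded, injectively, as data of the while-language. -/
class ToVal (α : Type) where
  toVal : α → Val
  inj : Function.Injective toVal

open ToVal (toVal)

/-- The size of the encoding of `a`. -/
def csize {α : Type} [ToVal α] (a : α) : ℕ := (toVal a).size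

instance : ToVal ℕ := ⟨Val.nat, fun _ _ h => Val.nat.inj h⟩

instance : ToVal Bool := ⟨Val.ofBool, by decide⟩

instance {α β : Type} [ToVal α] [ToVal β] : ToVal (α × β) where
  toVal p := .pair (toVal p.1) (toVal p.2)
  inj _ _ h := Prod.ext (ToVal.inj (Val.pair.inj h).1) (ToVal.inj (Val.pair.inj h).2)

theorem Val.ofList_injective : Function.Injective Val.ofList := by
  intro L
  induction L with
  | nil => rintro (_ | _) h <;> simp_all [Val.ofList]
  | cons a L ih =>
    rintro (_ | ⟨b, M⟩) h
    · simp [Val.ofList] at h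
    · simp only [Val.ofList, Val.pair.injEq] at h
      rw [h.1, ih h.2]

instance {α : Type} [ToVal α] : ToVal (List α) where
  toVal L := .ofList (L.map toVal)
  inj := Val.ofList_injective.comp (List.map_injective_iff.2 ToVal.inj)

section Encodings

variable {α β γ : Type} [ToVal α] [ToVal β] [ToVal γ]

theorem toVal_nat (n : ℕ) : toVal n = .nat n := rfl
theorem toVal_bool (b : Bool) : toVal b = .ofBool b := rfl
theorem toVal_pair (a : α) (b : β) : toVal (a, b) = .pair (toVal a) (toVal b) := rfl
theorem toVal_nil : toVal ([] : List α) = .nat 0 := rfl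
theorem toVal_cons (a : α) (L : List α) : toVal (a :: L) = .pair (toVal a) (toVal L) := rfl

theorem csize_nat (n : ℕ) : csize n = n.size + 1 := rfl

theorem csize_bool_le (b : Bool) : csize b ≤ 2 := by cases b <;> decide

theorem csize_pair (a : α) (b : β) : csize (a, b) = csize a + csize b + 1 := rfl
theorem csize_nil : csize ([] : List α) = 1 := rfl
theorem csize_cons (a : α) (L : List α) : csize (a :: L) = csize a + csize L + 1 := rfl

theorem csize_pos (a : α) : 0 < csize a := by
  unfold csize
  cases toVal a <;> simp [Val.size]

theorem length_lt_csize (L : List α) : L.length < csize L := by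
  induction L with
  | nil => simp [csize_nil]
  | cons a L ih => rw [csize_cons, List.length_cons]; omega

theorem csize_lt_of_mem {a : α} {L : List α} (h : a ∈ L) : csize a < csize L := by
  induction L with
  | nil => simp at h
  | cons b L ih =>
    rw [csize_cons]
    rcases List.mem_cons.1 h with rfl | h
    · have := csize_pos L; omega
    · have := ih h; omega

theorem csize_append (L M : List α) : csize (L ++ M) + 1 = csize L + csize M := by
  induction L with
  | nil => simp [csize_nil, add_comm]
  | cons a L ih => rw [List.cons_append, csize_cons, csize_cons]; omega

theorem csize_list_le {L : List α} {B : ℕ} (h : ∀ a ∈ L, csize a ≤ B) :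
    csize L ≤ L.length * (B + 1) + 1 := by
  induction L with
  | nil => simp [csize_nil]
  | cons a L ih =>
    have h1 := h a (by simp)
    have h2 := ih fun b hb => h b (by simp [hb])
    rw [csize_cons, List.length_cons, add_mul]
    omega

end Encodings

theorem Polynomial.eval_mono_nat (p : Polynomial ℕ) {m n : ℕ} (h : m ≤ n) :
    p.eval m ≤ p.eval n := by
  rw [Polynomial.eval_eq_sum, Polynomial.eval_eq_sum]
  exact Finset.sum_le_sum fun i _ => Nat.mul_le_mul_left _ (Nat.pow_le_pow_left h _)

/-- Sequential composition after a command without accesses to the oracle; the number of accesses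
is syntactically that of the second command, which lets it unify with a given number. -/
theorem Exec.seq_free {O : Val → List Val} {c d : Cmd} {σ σ₁ σ₂ : OState} {t t' q : ℕ}
    (h : Exec O c σ σ₁ t 0) (h' : Exec O d σ₁ σ₂ t' q) :
    Exec O (.seq c d) σ σ₂ (t + t' + 1) q := by
  simpa using h.seq h'

theorem Expr.size_eval_le_cost (ρ : ℕ → Val) (e : Expr) : (e.eval ρ).size ≤ e.cost ρ := by
  cases e <;> simp [Expr.eval, Expr.cost]

/-- Whatever the oracle is, the command `c` replaces the value of variable `n` by its image under
`f`, in time `p` and without accesses to the oracle. The variables below `n` keep their values, and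
those above `n` serve as scratch space. -/
def Cmd.Computes {α β : Type} [ToVal α] [ToVal β] (c : Cmd) (n : ℕ) (f : α → β)
    (p : Polynomial ℕ) : Prop :=
  ∀ (O : Val → List Val) (σ : OState) (a : α), σ.vars n = toVal a →
    ∃ (σ' : OState) (t : ℕ), Exec O c σ σ' t 0 ∧ σ'.vars n = toVal (f a) ∧
      (∀ x < n, σ'.vars x = σ.vars x) ∧ σ'.answer = σ.answer ∧ t ≤ p.eval (csize a)

/-- `f` is computable in polynomial time on encodings, with the argument and the result in an
arbitrary variable `n` and with scratch space above `n`. -/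
def PolyTime {α β : Type} [ToVal α] [ToVal β] (f : α → β) : Prop :=
  ∃ p : Polynomial ℕ, (∀ a, csize (f a) ≤ p.eval (csize a)) ∧ ∀ n, ∃ c : Cmd, c.Computes n f p

namespace PolyTime

variable {α β γ : Type} [ToVal α] [ToVal β] [ToVal γ]

/-- A function given by an expression is computed by one assignment. -/
theorem of_expr {f : α → β} (e : ℕ → Expr) (p : Polynomial ℕ)
    (he : ∀ (ρ : ℕ → Val) n a, ρ n = toVal a →
      (e n).eval ρ = toVal (f a) ∧ (e n).cost ρ ≤ p.eval (csize a)) : PolyTime f := by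
  refine ⟨p + 1, fun a => ?_, fun n => ⟨.assign n (e n), fun O σ a ha => ?_⟩⟩
  · obtain ⟨h1, h2⟩ := he (fun _ => toVal a) 0 a rfl
    have := (Expr.size_eval_le_cost _ _).trans h2
    rw [h1] at this
    simpa [csize] using this.trans (Nat.le_succ _)
  · obtain ⟨h1, h2⟩ := he σ.vars n a ha
    refine ⟨_, _, Exec.assign _ _ _, by simp [h1], fun x hx => ?_, rfl, by simpa using h2⟩
    simp [Function.update_of_ne hx.ne]

theorem id : PolyTime (fun a : α => a) :=
  of_expr .var Polynomial.X fun ρ n a h => by simp [Expr.eval, Expr.cost, h, csize]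

theorem fst : PolyTime (fun p : α × β => p.1) :=
  of_expr (fun n => .fst (.var n)) (2 * Polynomial.X) fun ρ n ⟨a, b⟩ h => by
    simp [Expr.eval, Expr.cost, h, csize, toVal_pair, Val.fst, Val.size]; omega

theorem snd : PolyTime (fun p : α × β => p.2) :=
  of_expr (fun n => .snd (.var n)) (2 * Polynomial.X) fun ρ n ⟨a, b⟩ h => by
    simp [Expr.eval, Expr.cost, h, csize, toVal_pair, Val.snd, Val.size]; omega

theorem const (b : β) : PolyTime (fun _ : α => b) := by
  have key : ∀ v : Val, ∃ e : Expr, ∃ k, ∀ ρ, e.eval ρ = v ∧ e.cost ρ ≤ k := by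
    intro v
    induction v with
    | nat n => exact ⟨.const n, _, fun ρ => ⟨rfl, le_rfl⟩⟩
    | pair a b iha ihb =>
      obtain ⟨e, k, h⟩ := iha
      obtain ⟨e', k', h'⟩ := ihb
      refine ⟨.pair e e', k + k' + (a.pair b).size, fun ρ => ?_⟩
      simp only [Expr.eval, Expr.cost, (h ρ).1, (h' ρ).1, true_and]
      have := (h ρ).2
      have := (h' ρ).2
      omega
  obtain ⟨e, k, h⟩ := key (toVal b)
  exact of_expr (fun _ => e) (k : Polynomial ℕ) fun ρ n a _ => by
    simpa using h ρ

theorem comp {g : β → γ} {f : α → β} (hg : PolyTime g) (hf : PolyTime f) :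
    PolyTime (fun a => g (f a)) := by
  obtain ⟨p, hp, cf⟩ := hf
  obtain ⟨q, hq, cg⟩ := hg
  have hqp : ∀ a, q.eval (csize (f a)) ≤ (q.comp p).eval (csize a) := fun a => by
    rw [Polynomial.eval_comp]
    exact q.eval_mono_nat (hp a)
  refine ⟨p + q.comp p + 1, fun a => ?_, fun n => ?_⟩
  · have := (hq (f a)).trans (hqp a)
    simp only [Polynomial.eval_add, Polynomial.eval_one]
    omega
  · obtain ⟨c, hc⟩ := cf n
    obtain ⟨d, hd⟩ := cg n
    refine ⟨.seq c d, fun O σ a ha => ?_⟩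
    obtain ⟨σ₁, t₁, e₁, v₁, k₁, a₁, b₁⟩ := hc O σ a ha
    obtain ⟨σ₂, t₂, e₂, v₂, k₂, a₂, b₂⟩ := hd O σ₁ (f a) v₁
    refine ⟨σ₂, _, e₁.seq_free e₂, v₂, fun x hx => (k₂ x hx).trans (k₁ x hx), a₂.trans a₁, ?_⟩
    have := b₂.trans (hqp a)
    simp only [Polynomial.eval_add, Polynomial.eval_one]
    omega

theorem pair {f : α → β} {g : α → γ} (hf : PolyTime f) (hg : PolyTime g) :
    PolyTime (fun a => (f a, g a)) := by
  obtain ⟨p, hp, cf⟩ := hf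
  obtain ⟨q, hq, cg⟩ := hg
  refine ⟨3 * p + 3 * q + 2 * Polynomial.X + 8, fun a => ?_, fun n => ?_⟩
  · have := hp a
    have := hq a
    simp [csize_pair]
    omega
  · obtain ⟨c, hc⟩ := cf (n + 1)
    obtain ⟨d, hd⟩ := cg (n + 2)
    refine ⟨.seq (.assign (n + 1) (.var n)) (.seq c (.seq (.assign (n + 2) (.var n))
      (.seq d (.assign n (.pair (.var (n + 1)) (.var (n + 2))))))), fun O σ a ha => ?_⟩
    obtain ⟨σ₁, t₁, e₁, v₁, k₁, a₁, b₁⟩ :=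
      hc O ⟨Function.update σ.vars (n + 1) (σ.vars n), σ.answer⟩ a (by simp [ha])
    have hn : σ₁.vars n = toVal a := by rw [k₁ n (by omega)]; simp [ha]
    obtain ⟨σ₂, t₂, e₂, v₂, k₂, a₂, b₂⟩ :=
      hd O ⟨Function.update σ₁.vars (n + 2) (σ₁.vars n), σ₁.answer⟩ a (by simp [hn])
    have h1 : σ₂.vars (n + 1) = toVal (f a) := by rw [k₂ (n + 1) (by omega)]; simp [v₁]
    refine ⟨_, _, (Exec.assign _ _ _).seq_free (e₁.seq_free ((Exec.assign _ _ _).seq_free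
      (e₂.seq_free (Exec.assign _ _ _)))), ?_, fun x hx => ?_, a₂.trans a₁, ?_⟩
    · simp [Expr.eval, v₂, h1, toVal_pair]
    · simp only [Function.update_of_ne hx.ne]
      rw [k₂ x (by omega)]
      simp only [Function.update_of_ne (show x ≠ n + 2 by omega)]
      rw [k₁ x (by omega)]
      simp only [Function.update_of_ne (show x ≠ n + 1 by omega)]
    · have := hp a
      have := hq a
      simp only [Expr.cost, Expr.eval, v₂, h1, ha, hn, Val.size, csize] at *
      simp
      omega

theorem ite {b : α → Bool} {f g : α → β} (hb : PolyTime b) (hf : PolyTime f) (hg : PolyTime g) :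
    PolyTime (fun a => if b a then f a else g a) := by
  obtain ⟨r, hr, cb⟩ := hb
  obtain ⟨p, hp, cf⟩ := hf
  obtain ⟨q, hq, cg⟩ := hg
  refine ⟨r + p + q + Polynomial.X + 6, fun a => ?_, fun n => ?_⟩
  · have := hp a
    have := hq a
    simp
    split <;> omega
  · obtain ⟨d, hd⟩ := cb (n + 1)
    obtain ⟨c₁, hc₁⟩ := cf n
    obtain ⟨c₂, hc₂⟩ := cg n
    refine ⟨.seq (.assign (n + 1) (.var n)) (.seq d (.ite (.var (n + 1)) c₁ c₂)),
      fun O σ a ha => ?_⟩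
    obtain ⟨σ₁, t₁, e₁, v₁, k₁, a₁, b₁⟩ :=
      hd O ⟨Function.update σ.vars (n + 1) (σ.vars n), σ.answer⟩ a (by simp [ha])
    have hn : σ₁.vars n = toVal a := by rw [k₁ n (by omega)]; simp [ha]
    have hk : ∀ x < n, σ₁.vars x = σ.vars x := fun x hx => by
      rw [k₁ x (by omega)]
      simp only [Function.update_of_ne (show x ≠ n + 1 by omega)]
    have hs : (toVal (b a)).size ≤ 2 := csize_bool_le _
    cases hba : b a with
    | true =>
      obtain ⟨σ₂, t₂, e₂, v₂, k₂, a₂, b₂⟩ := hc₁ O σ₁ a hn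
      refine ⟨σ₂, _, (Exec.assign _ _ _).seq_free (e₁.seq_free (Exec.ite_true ?_ e₂)), by simp [v₂, hba],
        fun x hx => (k₂ x hx).trans (hk x hx), a₂.trans a₁, ?_⟩
      · simp [Expr.eval, v₁, hba, toVal_bool, Val.ofBool]
      · simp only [Expr.cost, v₁, ha, csize] at *
        simp
        omega
    | false =>
      obtain ⟨σ₂, t₂, e₂, v₂, k₂, a₂, b₂⟩ := hc₂ O σ₁ a hn
      refine ⟨σ₂, _, (Exec.assign _ _ _).seq_free (e₁.seq_free (Exec.ite_false ?_ e₂)), by simp [v₂, hba],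
        fun x hx => (k₂ x hx).trans (hk x hx), a₂.trans a₁, ?_⟩
      · simp [Expr.eval, v₁, hba, toVal_bool, Val.ofBool]
      · simp only [Expr.cost, v₁, ha, csize] at *
        simp
        omega

/-! ### Arithmetic and comparison -/

theorem _root_.Nat.size_add_le (m n : ℕ) : (m + n).size ≤ m.size + n.size + 1 := by
  rw [Nat.size_le]
  have h1 := Nat.lt_size_self m
  have h2 := Nat.lt_size_self n
  have h3 : 2 ^ m.size ≤ 2 ^ (m.size + n.size) := Nat.pow_le_pow_right (by norm_num) (by omega)
  have h4 : 2 ^ n.size ≤ 2 ^ (m.size + n.size) := Nat.pow_le_pow_right (by norm_num) (by omega)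
  rw [pow_succ]
  omega

theorem _root_.Nat.size_mul_le (m n : ℕ) : (m * n).size ≤ m.size + n.size := by
  rw [Nat.size_le, pow_add]
  exact Nat.mul_lt_mul'' (Nat.lt_size_self m) (Nat.lt_size_self n)

theorem nat_add : PolyTime (fun p : ℕ × ℕ => p.1 + p.2) :=
  of_expr (fun n => .add (.fst (.var n)) (.snd (.var n))) (8 * Polynomial.X) fun ρ n ⟨a, b⟩ h => by
    have := Nat.size_add_le a b
    simp [Expr.eval, Expr.cost, h, csize, toVal_pair, toVal_nat, Val.fst, Val.snd, Val.size,
      Val.toNat]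
    omega

theorem nat_mul : PolyTime (fun p : ℕ × ℕ => p.1 * p.2) :=
  of_expr (fun n => .mul (.fst (.var n)) (.snd (.var n))) (8 * Polynomial.X) fun ρ n ⟨a, b⟩ h => by
    have := Nat.size_mul_le a b
    simp [Expr.eval, Expr.cost, h, csize, toVal_pair, toVal_nat, Val.fst, Val.snd, Val.size,
      Val.toNat]
    omega

theorem nat_lt : PolyTime (fun p : ℕ × ℕ => decide (p.1 < p.2)) :=
  of_expr (fun n => .lt (.fst (.var n)) (.snd (.var n))) (8 * Polynomial.X) fun ρ n ⟨a, b⟩ h => by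
    have := csize_bool_le (decide (a < b))
    simp [Expr.eval, Expr.cost, h, csize, toVal_pair, toVal_nat, Val.fst, Val.snd, Val.size,
      Val.toNat, toVal_bool] at *
    omega

theorem decide_eq [DecidableEq α] : PolyTime (fun p : α × α => decide (p.1 = p.2)) :=
  of_expr (fun n => .eq (.fst (.var n)) (.snd (.var n))) (8 * Polynomial.X) fun ρ n ⟨a, b⟩ h => by
    have := csize_bool_le (decide (a = b))
    simp [Expr.eval, Expr.cost, h, csize, toVal_pair, Val.fst, Val.snd, Val.size,
      toVal_bool, ToVal.inj.eq_iff] at *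
    omega

theorem not {b : α → Bool} (hb : PolyTime b) : PolyTime (fun a => !b a) := by
  have := hb.ite (const false) (const true)
  convert this using 2 with a
  cases b a <;> rfl

theorem and {b c : α → Bool} (hb : PolyTime b) (hc : PolyTime c) :
    PolyTime (fun a => b a && c a) := by
  have := hb.ite hc (const false)
  convert this using 2 with a
  cases b a <;> rfl

theorem or {b c : α → Bool} (hb : PolyTime b) (hc : PolyTime c) :
    PolyTime (fun a => b a || c a) := by
  have := hb.ite (const true) hc
  convert this using 2 with a
  cases b a <;> rfl

theorem cons : PolyTime (fun p : α × List α => p.1 :: p.2) :=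
  of_expr .var Polynomial.X fun ρ n ⟨a, b⟩ h => by
    simp [Expr.eval, Expr.cost, h, csize, toVal_pair, toVal_cons]

/-! ### Iteration over lists -/

/-- The expression that is true exactly if variable `x` holds a pair: a pair equals the pair of its
components, and a leaf equals no pair. -/
def isPair (x : ℕ) : Expr := .eq (.var x) (.pair (.fst (.var x)) (.snd (.var x)))

/-- The loop of `PolyTime.foldl`: the context is in variable `n`, the rest of the list in `n + 1`,
the accumulator in `n + 2`, and `c` computes the step function in variable `n + 3`. -/
def foldLoop (n : ℕ) (c : Cmd) : Cmd :=
  .loop (isPair (n + 1))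
    (.seq (.assign (n + 3) (.pair (.var n) (.pair (.fst (.var (n + 1))) (.var (n + 2)))))
      (.seq c (.seq (.assign (n + 2) (.var (n + 3))) (.assign (n + 1) (.snd (.var (n + 1)))))))

/-- The loop of a fold, with a bound `M` on the sizes of all the values that occur in it. -/
theorem exec_foldLoop {step : γ → α → β → β} {p : Polynomial ℕ} {n : ℕ} {c : Cmd}
    (hc : c.Computes (n + 3) (fun q : γ × α × β => step q.1 q.2.1 q.2.2) p)
    (O : Val → List Val) (g : γ) (M : ℕ) (L : List α) (b : β) (σ : OState)
    (hg : σ.vars n = toVal g) (hL : σ.vars (n + 1) = toVal L) (hb : σ.vars (n + 2) = toVal b)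
    (hgM : csize g ≤ M) (hLM : csize L ≤ M)
    (hbM : ∀ L', L' <+: L → csize (L'.foldl (fun b a => step g a b) b) ≤ M) :
    ∃ (σ' : OState) (t : ℕ), Exec O (foldLoop n c) σ σ' t 0 ∧
      σ'.vars (n + 2) = toVal (L.foldl (fun b a => step g a b) b) ∧
      (∀ x < n, σ'.vars x = σ.vars x) ∧ σ'.answer = σ.answer ∧
      t ≤ (L.length + 1) * (p.eval (3 * M + 2) + 30 * M + 30) := by
  induction L generalizing b σ with
  | nil =>
    refine ⟨σ, _, Exec.loop_false ?_, by simpa using hb, fun _ _ => rfl, rfl, ?_⟩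
    · simp [isPair, Expr.eval, hL, toVal_nil, Val.ofBool]
    · simp [isPair, Expr.eval, Expr.cost, hL, toVal_nil, Val.ofBool, Val.fst, Val.snd, Val.size]
  | cons a L ih =>
    have hb0 := hbM [] (List.nil_prefix)
    have hb1 := hbM [a] ⟨L, rfl⟩
    simp only [List.foldl_nil, List.foldl_cons] at hb0 hb1
    rw [csize_cons] at hLM
    obtain ⟨σ₁, t₁, e₁, v₁, k₁, a₁, b₁⟩ := hc O
      ⟨Function.update σ.vars (n + 3) (.pair (toVal g) (.pair (toVal a) (toVal b))), σ.answer⟩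
      (g, a, b) (by simp [toVal_pair])
    have kn : σ₁.vars n = toVal g := by rw [k₁ n (by omega)]; simp [hg]
    have kL : σ₁.vars (n + 1) = toVal (a :: L) := by rw [k₁ (n + 1) (by omega)]; simp [hL]
    obtain ⟨σ₂, t₂, e₂, v₂, k₂, a₂, b₂⟩ := ih (step g a b)
      ⟨Function.update (Function.update σ₁.vars (n + 2) (σ₁.vars (n + 3))) (n + 1) (toVal L),
        σ₁.answer⟩ (by simp [kn]) (by simp) (by simp [v₁]) (by omega) fun L' hL' =>
          hbM (a :: L') (List.cons_prefix_cons.2 ⟨rfl, hL'⟩)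
    have hev : (Expr.pair (.var n) (.pair (.fst (.var (n + 1))) (.var (n + 2)))).eval σ.vars =
        .pair (toVal g) (.pair (toVal a) (toVal b)) := by
      simp [Expr.eval, hg, hL, hb, toVal_cons, Val.fst]
    have E₁ := Exec.assign (O := O) (n + 3)
      (.pair (.var n) (.pair (.fst (.var (n + 1))) (.var (n + 2)))) σ
    rw [hev] at E₁
    have E₂ := Exec.assign (O := O) (n + 1) (.snd (.var (n + 1)))
      ⟨Function.update σ₁.vars (n + 2) (σ₁.vars (n + 3)), σ₁.answer⟩
    have hev₂ : (Expr.snd (.var (n + 1))).eval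
        (Function.update σ₁.vars (n + 2) (σ₁.vars (n + 3))) = toVal L := by
      simp [Expr.eval, kL, toVal_cons, Val.snd]
    simp only [hev₂] at E₂
    have E := Exec.loop_true (a := isPair (n + 1)) (σ := σ)
      (by simp [isPair, Expr.eval, hL, toVal_cons, Val.ofBool, Val.fst, Val.snd])
      (E₁.seq_free (e₁.seq_free ((Exec.assign (n + 2) (.var (n + 3)) σ₁).seq_free E₂))) e₂
    refine ⟨σ₂, _, E, v₂, fun x hx => ?_, a₂.trans a₁, ?_⟩
    · rw [k₂ x hx]
      simp only [Function.update_of_ne (show x ≠ n + 1 by omega),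
        Function.update_of_ne (show x ≠ n + 2 by omega)]
      rw [k₁ x (by omega)]
      simp only [Function.update_of_ne (show x ≠ n + 3 by omega)]
    · have hp : t₁ ≤ p.eval (3 * M + 2) := b₁.trans (p.eval_mono_nat (by
        rw [csize_pair, csize_pair]; omega))
      rw [List.length_cons, add_mul _ 1, one_mul]
      simp [isPair, Expr.eval, Expr.cost, hL, hg, hb, kL, v₁, toVal_cons, Val.ofBool, Val.fst,
        Val.snd, Val.size, csize] at *
      omega

/-- Folding a step function over a list takes polynomial time, provided that the accumulator stays
of polynomial size. -/
theorem foldl {l : γ → List α} {z : γ → β} {step : γ → α → β → β} (hl : PolyTime l)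
    (hz : PolyTime z) (hs : PolyTime (fun q : γ × α × β => step q.1 q.2.1 q.2.2))
    (hB : ∃ q : Polynomial ℕ, ∀ g L, L <+: l g →
      csize (L.foldl (fun b a => step g a b) (z g)) ≤ q.eval (csize g)) :
    PolyTime (fun g => (l g).foldl (fun b a => step g a b) (z g)) := by
  obtain ⟨q, hq⟩ := hB
  obtain ⟨p₁, h₁, c₁⟩ := id.pair (hl.pair hz)
  obtain ⟨p, -, cs⟩ := hs
  let M : Polynomial ℕ := p₁ + q
  refine ⟨p₁ + q + 40 * M + 40 + (M + 1) * (p.comp (3 * M + 2) + 30 * M + 30),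
    fun g => ?_, fun n => ?_⟩
  · have := hq g (l g) (List.prefix_refl _)
    simp only [Polynomial.eval_add]
    omega
  obtain ⟨d, hd⟩ := c₁ n
  obtain ⟨c, hc⟩ := cs (n + 3)
  refine ⟨.seq d (.seq (.assign (n + 1) (.fst (.snd (.var n))))
    (.seq (.assign (n + 2) (.snd (.snd (.var n)))) (.seq (.assign n (.fst (.var n)))
      (.seq (foldLoop n c) (.assign n (.var (n + 2))))))), fun O σ g hg => ?_⟩
  obtain ⟨σ₁, t₁, e₁, v₁, k₁, a₁, b₁⟩ := hd O σ g hg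
  have hsz := h₁ g
  simp only [csize_pair] at hsz
  have hM : M.eval (csize g) = p₁.eval (csize g) + q.eval (csize g) := by simp [M]
  obtain ⟨σ₂, t₂, e₂, v₂, k₂, a₂, b₂⟩ := exec_foldLoop hc O g (M.eval (csize g)) (l g) (z g)
    ⟨Function.update (Function.update (Function.update σ₁.vars (n + 1) (toVal (l g)))
      (n + 2) (toVal (z g))) n (toVal g), σ₁.answer⟩ (by simp) (by simp) (by simp)
    (by omega) (by omega) (fun L' hL' => by have := hq g L' hL'; omega)
  have E₁ := Exec.assign (O := O) (n + 1) (.fst (.snd (.var n))) σ₁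
  have hev₁ : (Expr.fst (.snd (.var n))).eval σ₁.vars = toVal (l g) := by
    simp [Expr.eval, v₁, toVal_pair, Val.fst, Val.snd]
  rw [hev₁] at E₁
  have E₂ := Exec.assign (O := O) (n + 2) (.snd (.snd (.var n)))
    ⟨Function.update σ₁.vars (n + 1) (toVal (l g)), σ₁.answer⟩
  have hev₂ : (Expr.snd (.snd (.var n))).eval (Function.update σ₁.vars (n + 1) (toVal (l g))) =
      toVal (z g) := by
    simp [Expr.eval, v₁, toVal_pair, Val.snd]
  simp only [hev₂] at E₂
  have E₃ := Exec.assign (O := O) n (.fst (.var n)) ⟨Function.update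
    (Function.update σ₁.vars (n + 1) (toVal (l g))) (n + 2) (toVal (z g)), σ₁.answer⟩
  have hev₃ : (Expr.fst (.var n)).eval (Function.update
      (Function.update σ₁.vars (n + 1) (toVal (l g))) (n + 2) (toVal (z g))) = toVal g := by
    simp [Expr.eval, v₁, toVal_pair, Val.fst]
  simp only [hev₃] at E₃
  refine ⟨_, _, e₁.seq_free (E₁.seq_free (E₂.seq_free (E₃.seq_free (e₂.seq_free
    (Exec.assign _ _ _))))), by simp [Expr.eval, v₂], fun x hx => ?_, a₂.trans a₁, ?_⟩
  · simp only [Function.update_of_ne hx.ne]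
    rw [k₂ x hx]
    simp only [Function.update_of_ne hx.ne, Function.update_of_ne (show x ≠ n + 1 by omega),
        Function.update_of_ne (show x ≠ n + 2 by omega)]
    exact k₁ x hx
  · have h3 := hq g (l g) (List.prefix_refl _)
    have h4 : t₂ ≤ (M.eval (csize g) + 1) *
        (p.eval (3 * M.eval (csize g) + 2) + 30 * M.eval (csize g) + 30) :=
      b₂.trans (Nat.mul_le_mul_right _ (by have := length_lt_csize (l g); omega))
    simp only [Polynomial.eval_add, Polynomial.eval_mul, Polynomial.eval_comp, Polynomial.eval_one,
      Polynomial.eval_ofNat]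
    rw [csize] at hsz h3
    simp [Expr.eval, Expr.cost, v₁, v₂, toVal_pair, Val.fst, Val.snd, Val.size, csize] at *
    omega

/-- In `PolyTime.foldl` it suffices that a step increases the size of the accumulator by a
polynomial in the sizes of the context and of the current entry of the list. -/
theorem foldl_of_growth {l : γ → List α} {z : γ → β} {step : γ → α → β → β} (hl : PolyTime l)
    (hz : PolyTime z) (hs : PolyTime (fun q : γ × α × β => step q.1 q.2.1 q.2.2))
    (r : Polynomial ℕ) (hr : ∀ g a b, csize (step g a b) ≤ csize b + r.eval (csize g + csize a)) :
    PolyTime (fun g => (l g).foldl (fun b a => step g a b) (z g)) := by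
  refine foldl hl hz hs ?_
  obtain ⟨p, hp, -⟩ := hl
  obtain ⟨q, hq, -⟩ := hz
  have key : ∀ g R (L : List α) (b : β), (∀ a ∈ L, r.eval (csize g + csize a) ≤ R) →
      csize (L.foldl (fun b a => step g a b) b) ≤ csize b + L.length * R := by
    intro g R L
    induction L with
    | nil => simp
    | cons a L ih =>
      intro b hL
      have h1 := hr g a b
      have h2 := hL a (by simp)
      have h3 := ih (step g a b) fun a ha => hL a (by simp [ha])
      rw [List.foldl_cons, List.length_cons, add_mul]
      omega
  refine ⟨q + p * r.comp (Polynomial.X + p), fun g L hL => ?_⟩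
  have h1 := key g (r.eval (csize g + p.eval (csize g))) L (z g) fun a ha =>
    r.eval_mono_nat (by have := csize_lt_of_mem (hL.subset ha); have := hp g; omega)
  have h2 : L.length ≤ p.eval (csize g) := by
    have := hL.length_le
    have := length_lt_csize (l g)
    have := hp g
    omega
  have h3 := hq g
  have h4 := Nat.mul_le_mul_right (r.eval (csize g + p.eval (csize g))) h2
  simp only [Polynomial.eval_add, Polynomial.eval_mul, Polynomial.eval_comp, Polynomial.eval_X]
  omega

theorem reverse {l : γ → List α} (hl : PolyTime l) : PolyTime (fun g => (l g).reverse) := by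
  have := foldl_of_growth (step := fun (_ : γ) a (b : List α) => a :: b) hl (const [])
    (cons.comp snd) (Polynomial.X + 1) (by
      intro g a b
      simp [csize_cons]
      omega)
  simpa using this

theorem foldr_of_growth {l : γ → List α} {z : γ → β} {step : γ → α → β → β} (hl : PolyTime l)
    (hz : PolyTime z) (hs : PolyTime (fun q : γ × α × β => step q.1 q.2.1 q.2.2))
    (r : Polynomial ℕ) (hr : ∀ g a b, csize (step g a b) ≤ csize b + r.eval (csize g + csize a)) :
    PolyTime (fun g => (l g).foldr (step g) (z g)) := by
  have := foldl_of_growth hl.reverse hz hs r hr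
  simpa [List.foldl_reverse] using this

theorem append {f g : γ → List α} (hf : PolyTime f) (hg : PolyTime g) :
    PolyTime (fun c => f c ++ g c) := by
  have := foldr_of_growth (step := fun (_ : γ) a (b : List α) => a :: b) hf hg
    (cons.comp snd) (Polynomial.X + 1) (by
      intro g a b
      simp [csize_cons]
      omega)
  convert this using 2 with c
  simp

theorem flatMap {l : γ → List α} {f : γ → α → List β} (hl : PolyTime l)
    (hf : PolyTime (fun q : γ × α => f q.1 q.2)) : PolyTime (fun g => (l g).flatMap (f g)) := by
  have hf' := hf
  obtain ⟨p, hp, -⟩ := hf'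
  have := foldr_of_growth (step := fun g a (b : List β) => f g a ++ b) hl (const [])
    ((hf.comp (fst.pair (fst.comp snd))).append (snd.comp snd))
    (p.comp (Polynomial.X + 1)) (by
      intro g a b
      have h1 := hp (g, a)
      have h2 := csize_append (f g a) b
      rw [csize_pair] at h1
      simp only [Polynomial.eval_comp, Polynomial.eval_add, Polynomial.eval_X, Polynomial.eval_one]
      simp only at h1
      omega)
  convert this using 2 with g
  induction l g with
  | nil => rfl
  | cons a L ih => simp [ih]

theorem map {l : γ → List α} {f : γ → α → β} (hl : PolyTime l)
    (hf : PolyTime (fun q : γ × α => f q.1 q.2)) : PolyTime (fun g => (l g).map (f g)) := by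
  have := hl.flatMap (f := fun g a => [f g a]) (cons.comp (hf.pair (const [])))
  convert this using 2 with g
  exact (List.flatMap_pure_eq_map (f g) (l g)).symm

theorem filter {l : γ → List α} {f : γ → α → Bool} (hl : PolyTime l)
    (hf : PolyTime (fun q : γ × α => f q.1 q.2)) : PolyTime (fun g => (l g).filter (f g)) := by
  have := hl.flatMap (f := fun g a => if f g a then [a] else [])
    (hf.ite (cons.comp (snd.pair (const []))) (const []))
  convert this using 2 with g
  induction l g with
  | nil => rfl
  | cons a L ih => simp only [List.filter_cons, List.flatMap_cons, ih]; split <;> rfl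

theorem all {l : γ → List α} {f : γ → α → Bool} (hl : PolyTime l)
    (hf : PolyTime (fun q : γ × α => f q.1 q.2)) : PolyTime (fun g => (l g).all (f g)) := by
  have := foldr_of_growth (step := fun g a (b : Bool) => f g a && b) hl (const true)
    ((hf.comp (fst.pair (fst.comp snd))).and (snd.comp snd)) 2 (by
      intro g a b
      have := csize_bool_le (f g a && b)
      simp
      omega)
  convert this using 2 with g
  induction l g with
  | nil => rfl
  | cons a L ih => simp [ih]

theorem any {l : γ → List α} {f : γ → α → Bool} (hl : PolyTime l)
    (hf : PolyTime (fun q : γ × α => f q.1 q.2)) : PolyTime (fun g => (l g).any (f g)) := by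
  have := (hl.all (f := fun g a => !f g a) hf.not).not
  convert this using 2 with g
  rw [List.any_eq_not_all_not]

theorem decide_mem [DecidableEq α] [∀ (a : α) (l : List α), Decidable (a ∈ l)]
    {l : γ → List α} {f : γ → α} (hf : PolyTime f)
    (hl : PolyTime l) : PolyTime (fun g => decide (f g ∈ l g)) := by
  have := hl.any (f := fun g a => decide (f g = a)) (decide_eq.comp ((hf.comp fst).pair snd))
  convert this using 2 with g
  rw [Bool.eq_iff_iff]
  simp

theorem length {l : γ → List α} (hl : PolyTime l) : PolyTime (fun g => (l g).length) := by
  have := foldr_of_growth (step := fun (_ : γ) (_ : α) (b : ℕ) => b + 1) hl (const 0)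
    (nat_add.comp ((snd.comp snd).pair (const 1))) 2 (by
      intro g a b
      have := Nat.size_add_le b 1
      simp [csize_nat] at *
      omega)
  convert this using 2 with g
  induction l g with
  | nil => rfl
  | cons a L ih => simp [← ih]

/-- Here the fold appends to the list its current length. The size of that length is not bounded
by the context and the entry alone, so `PolyTime.foldl_of_growth` does not apply. -/
theorem range_length {l : γ → List α} (hl : PolyTime l) :
    PolyTime (fun g => List.range (l g).length) := by
  have key : ∀ L : List α, L.foldl (fun (b : List ℕ) _ => b ++ [b.length]) [] =
      List.range L.length := by
    intro L
    induction L using List.reverseRecOn with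
    | nil => rfl
    | append_singleton L a ih => simp [ih, List.range_succ]
  have := foldl (step := fun (_ : γ) (_ : α) (b : List ℕ) => b ++ [b.length]) hl (const [])
    ((snd.comp snd).append (cons.comp ((length (snd.comp snd)).pair (const [])))) (by
      obtain ⟨p, hp, -⟩ := hl
      refine ⟨p * (p + 2) + 1, fun g L hL => ?_⟩
      rw [key]
      have h1 : L.length ≤ p.eval (csize g) := by
        have := hL.length_le
        have := length_lt_csize (l g)
        have := hp g
        omega
      have h2 := csize_list_le (L := List.range L.length) (B := L.length + 1) fun i hi => by
        rw [csize_nat]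
        have h3 : i.size ≤ i := Nat.size_le.2 Nat.lt_two_pow_self
        have := List.mem_range.1 hi
        omega
      rw [List.length_range, show L.length + 1 + 1 = L.length + 2 from rfl] at h2
      simp only [Polynomial.eval_add, Polynomial.eval_mul, Polynomial.eval_one,
        Polynomial.eval_ofNat]
      have := Nat.mul_le_mul h1 (Nat.add_le_add_right h1 2)
      omega)
  simpa [key] using this

theorem getD {l : γ → List α} {i : γ → ℕ} (hl : PolyTime l) (hi : PolyTime i) (d : α) :
    PolyTime (fun g => (l g).getD (i g) d) := by
  -- The fold carries the index of the current entry and keeps the entry at index `i`.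
  have key : ∀ (L : List α) i j r, j ≤ i →
      (L.foldl (fun (b : ℕ × α) a => (b.1 + 1, if decide (b.1 = i) then a else b.2)) (j, r)).2 =
        L.getD (i - j) r := by
    intro L i
    induction L with
    | nil => simp
    | cons a L ih =>
      intro j r hj
      rcases hj.eq_or_lt with rfl | hj
      · have h : ∀ (L : List α) k r, j < k → (L.foldl (fun (b : ℕ × α) a =>
            (b.1 + 1, if decide (b.1 = j) then a else b.2)) (k, r)).2 = r := by
          intro L
          induction L with
          | nil => simp
          | cons a L ih =>
            intro k r hk
            simp only [List.foldl_cons, hk.ne', decide_false]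
            exact ih _ _ (by omega)
        simp only [List.foldl_cons, decide_true, if_true]
        rw [h _ _ _ (by omega)]
        simp
      · simp only [List.foldl_cons, hj.ne, decide_false]
        rw [if_neg (by simp), ih (j + 1) r (by omega), show i - j = (i - (j + 1)) + 1 by omega]
        simp
  have := snd.comp (foldl_of_growth (step := fun (g : γ) (a : α) (b : ℕ × α) =>
      (b.1 + 1, if decide (b.1 = i g) then a else b.2)) hl (const (0, d))
    ((nat_add.comp ((fst.comp (snd.comp snd)).pair (const 1))).pair
      (ite (decide_eq.comp ((fst.comp (snd.comp snd)).pair (hi.comp fst)))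
        (fst.comp snd) (snd.comp (snd.comp snd)))) (Polynomial.X + 2) (by
      intro g a b
      have h1 := Nat.size_add_le b.1 1
      have h2 : csize b = csize b.1 + csize b.2 + 1 := csize_pair _ _
      rw [csize_pair, h2]
      simp [csize_nat] at *
      split <;> omega))
  convert this using 2 with g
  rw [key _ _ 0 d (Nat.zero_le _)]
  simp

end PolyTime

/-! ### Counting supporting transaction sequences on encodings -/

/-- An encoded transaction: its id and the membership bits of its itemset. -/
abbrev TransCode : Type := ℕ × List Bool

/-- An encoded vertex: its row of the adjacency matrix and its transaction database. -/
abbrev VertexCode : Type := List Bool × List TransCode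

/-- An encoded database graph: the list of its items and the list of its vertices. -/
abbrev GraphCode : Type := List ℕ × List VertexCode

/-- The adjacency of two vertices that are given by their indices. -/
def codeAdj (V : List VertexCode) (v w : ℕ) : Bool :=
  (V.getD v ([], [])).1.getD w false

/-- The extensions, to the front, of a simple path and of a transaction sequence along it by one
vertex and one of its transactions. -/
def extendPath (V : List VertexCode) (x : List ℕ × List TransCode) :
    List (List ℕ × List TransCode) :=
  (List.range V.length).flatMap fun w =>
    if (decide (x.1 = []) || codeAdj V w (x.1.getD 0 0)) && !decide (w ∈ x.1) then
      (V.getD w ([], [])).2.map fun T => (w :: x.1, T :: x.2)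
    else []

/-- The simple paths with `k` vertices, each with all the transaction sequences along it. -/
def labelledPaths (V : List VertexCode) : ℕ → List (List ℕ × List TransCode)
  | 0 => [([], [])]
  | k + 1 => (labelledPaths V k).flatMap (extendPath V)

/-- The transaction sequences along simple paths with `k` vertices, without repetitions. -/
def codeSeqs (V : List VertexCode) (k : ℕ) : List (List TransCode) :=
  (labelledPaths V k).foldl (fun b x => if decide (x.2 ∈ b) then b else x.2 :: b) []

/-- Whether a transaction sequence of length `k` contains a pattern, for the items `items`. -/
def codeContains (items : List ℕ) (k : ℕ) (s : List (List Bool)) (xs : List TransCode) : Bool :=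
  (List.range k).all fun i => items.all fun j =>
    !(s.getD i []).getD j false || (xs.getD i (0, [])).2.getD j false

/-- Whether `s` encodes a pattern whose frequency exceeds the threshold `a / b`. The encoding of the
empty list is what reading beyond the end of an answer gives; it encodes no pattern. -/
def codeExceeds (k : ℕ) (x : GraphCode × ℕ × ℕ) (s : List (List Bool)) : Bool :=
  !decide (s = []) && decide (x.2.1 * (codeSeqs x.1.2 k).length <
    x.2.2 * ((codeSeqs x.1.2 k).filter (codeContains x.1.1 k s)).length)

/-- The number `2 ^ (|I| * k)` of sequences of `k` itemsets, an upper bound for the number of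
patterns. It is computed by a fold, since the exponent depends on the instance. -/
def codeBound (k : ℕ) (x : GraphCode × ℕ × ℕ) : ℕ :=
  x.1.1.foldl (fun b _ => b * 2 ^ k) 1

namespace PolyTime

variable {γ : Type} [ToVal γ]

theorem codeAdj {V : γ → List VertexCode} {v w : γ → ℕ} (hV : PolyTime V) (hv : PolyTime v)
    (hw : PolyTime w) : PolyTime (fun g => codeAdj (V g) (v g) (w g)) :=
  (fst.comp (hV.getD hv ([], []))).getD hw false

theorem extendPath : PolyTime (fun q : List VertexCode × List ℕ × List TransCode =>
    extendPath q.1 q.2) := by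
  refine flatMap (range_length fst) (ite ?_ ?_ (const []))
  · have hvs : PolyTime fun q : (List VertexCode × List ℕ × List TransCode) × ℕ => q.1.2.1 :=
      fst.comp (snd.comp fst)
    exact ((decide_eq.comp (hvs.pair (const []))).or
      (codeAdj (fst.comp fst) snd (hvs.getD (const 0) 0))).and (decide_mem snd hvs).not
  · exact map (f := fun (q : (List VertexCode × List ℕ × List TransCode) × ℕ) (T : TransCode) =>
        (q.2 :: q.1.2.1, T :: q.1.2.2))
      (snd.comp (getD (fst.comp fst) snd ([], [])))
      ((cons.comp (pair (snd.comp fst) (fst.comp (snd.comp (fst.comp fst))))).pair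
        (cons.comp (pair snd (snd.comp (snd.comp (fst.comp fst))))))

theorem labelledPaths (k : ℕ) : PolyTime (fun V => labelledPaths V k) := by
  induction k with
  | zero => exact const _
  | succ k ih => exact ih.flatMap extendPath

theorem codeSeqs (k : ℕ) : PolyTime (fun V => codeSeqs V k) := by
  refine foldl_of_growth (step := fun (_ : List VertexCode) (x : List ℕ × List TransCode)
    (b : List (List TransCode)) => if decide (x.2 ∈ b) then b else x.2 :: b)
    (labelledPaths k) (const []) ?_ (Polynomial.X + 1) fun g a b => ?_
  · have hx : PolyTime fun q : List VertexCode × (List ℕ × List TransCode) ×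
        List (List TransCode) => q.2.1.2 := snd.comp (fst.comp snd)
    exact (hx.decide_mem (snd.comp snd)).ite (snd.comp snd) (cons.comp (hx.pair (snd.comp snd)))
  · have h : csize a = csize a.1 + csize a.2 + 1 := csize_pair _ _
    rw [h]
    split
    · omega
    · rw [csize_cons]
      simp
      omega

theorem codeContains {items : γ → List ℕ} (k : ℕ) {s : γ → List (List Bool)}
    {xs : γ → List TransCode} (hi : PolyTime items) (hs : PolyTime s) (hx : PolyTime xs) :
    PolyTime (fun g => codeContains (items g) k (s g) (xs g)) :=
  all (f := fun g i => (items g).all fun j =>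
      !((s g).getD i []).getD j false || ((xs g).getD i (0, [])).2.getD j false)
    (const (List.range k)) (all (f := fun (q : γ × ℕ) j =>
      !((s q.1).getD q.2 []).getD j false || ((xs q.1).getD q.2 (0, [])).2.getD j false)
    (hi.comp fst)
    ((((hs.comp (fst.comp fst)).getD (snd.comp fst) []).getD snd false).not.or
      ((snd.comp ((hx.comp (fst.comp fst)).getD (snd.comp fst) (0, []))).getD snd false)))

theorem codeExceeds (k : ℕ) :
    PolyTime (fun q : (GraphCode × ℕ × ℕ) × List (List Bool) => codeExceeds k q.1 q.2) := by
  have hseq : PolyTime fun q : (GraphCode × ℕ × ℕ) × List (List Bool) =>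
      _root_.codeSeqs q.1.1.2 k := (codeSeqs k).comp (snd.comp (fst.comp fst))
  refine (decide_eq.comp (snd.pair (const []))).not.and (nat_lt.comp (pair ?_ ?_))
  · exact nat_mul.comp ((fst.comp (snd.comp fst)).pair hseq.length)
  · exact nat_mul.comp ((snd.comp (snd.comp fst)).pair (length (hseq.filter
      (f := fun q xs => _root_.codeContains q.1.1.1 k q.2 xs)
      (codeContains k (fst.comp (fst.comp (fst.comp fst))) (snd.comp fst) snd))))

theorem codeBound (k : ℕ) : PolyTime (codeBound k) :=
  foldl_of_growth (step := fun (_ : GraphCode × ℕ × ℕ) (_ : ℕ) b => b * 2 ^ k)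
    (fst.comp fst) (const 1) (nat_mul.comp ((snd.comp snd).pair (const (2 ^ k))))
    (k + 1 : Polynomial ℕ) fun g a b => by
      have := Nat.size_mul_le b (2 ^ k)
      rw [Nat.size_pow] at this
      simp [csize_nat]
      omega

end PolyTime

/-! ### Correctness of the counts -/

/-- The membership bits of a set of items. -/
def itemBits {m : ℕ} (X : Finset (Fin m)) : List Bool :=
  (List.finRange m).map fun i => decide (i ∈ X)

/-- The transaction `T` as a `TransCode`. -/
def transCode {m : ℕ} (T : Transaction m) : TransCode := (T.1, itemBits T.2)

/-- A transaction sequence as a list of `TransCode`s. -/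
def seqCode {m k : ℕ} (ts : Fin k → Transaction m) : List TransCode :=
  (List.finRange k).map fun i => transCode (ts i)

/-- The pattern `s` as the list of its bit lists. -/
def patternCode {G : DBGraph} {l : ℕ} (s : G.Pattern l) : List (List Bool) :=
  (List.finRange (l + 1)).map fun i => itemBits (s i)

/-- The database graph `G` as a `GraphCode`. -/
def graphCode (G : DBGraph) : GraphCode :=
  ((List.finRange G.numItems).map Fin.val,
    (List.finRange G.numVertices).map fun v =>
      ((List.finRange G.numVertices).map fun w => decide ((v, w) ∈ G.edges),
        (G.db v).map transCode))

theorem toVal_itemBits {m : ℕ} (X : Finset (Fin m)) : toVal (itemBits X) = codeItemset X := by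
  simp only [toVal, itemBits, codeItemset, List.map_map, Function.comp_def]

theorem toVal_transCode {m : ℕ} (T : Transaction m) : toVal (transCode T) = codeTransaction T := by
  rw [transCode, toVal_pair, toVal_itemBits]
  rfl

theorem toVal_patternCode {G : DBGraph} {l : ℕ} (s : G.Pattern l) :
    toVal (patternCode s) = codePattern s := by
  simp only [codePattern, ← toVal_itemBits]
  simp only [toVal, patternCode, List.map_map, Function.comp_def]

theorem toVal_list {α : Type} [ToVal α] (L : List α) : toVal L = .ofList (L.map toVal) := rfl

theorem toVal_graphCode (G : DBGraph) : toVal (graphCode G) = codeGraph G := by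
  -- In `codeGraph` the coercion of the items to numbers is lifted to the whole list.
  have h : (do let i ← List.finRange G.numItems; pure (i : ℕ)) =
      (List.finRange G.numItems).map Fin.val := List.flatMap_pure_eq_map _ _
  simp only [graphCode, codeGraph, h, toVal_pair, toVal_list, List.map_map, Function.comp_def,
    toVal_transCode]
  rfl

theorem getD_map_finRange {α : Type} {k : ℕ} (f : Fin k → α) (i : Fin k) (d : α) :
    ((List.finRange k).map f).getD i d = f i := by
  rw [List.getD_eq_getElem _ _ (by simp)]
  simp

theorem itemBits_getD {m : ℕ} (X : Finset (Fin m)) (i : Fin m) :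
    (itemBits X).getD i false = decide (i ∈ X) :=
  getD_map_finRange _ i _

theorem itemBits_injective {m : ℕ} : Function.Injective (itemBits (m := m)) := by
  intro X Y h
  ext i
  have h2 := itemBits_getD X i
  rw [h, itemBits_getD] at h2
  simpa [eq_comm] using h2

theorem transCode_injective {m : ℕ} : Function.Injective (transCode (m := m)) := by
  rintro ⟨a, X⟩ ⟨b, Y⟩ h
  simp only [transCode, Prod.mk.injEq] at h
  rw [h.1, itemBits_injective h.2]

theorem seqCode_eq_ofFn {m k : ℕ} (ts : Fin k → Transaction m) :
    seqCode ts = (List.ofFn ts).map transCode := by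
  rw [List.ofFn_eq_map, List.map_map]
  rfl

theorem seqCode_injective {m k : ℕ} : Function.Injective (seqCode (m := m) (k := k)) := by
  intro ts ts' h
  rw [seqCode_eq_ofFn, seqCode_eq_ofFn] at h
  exact List.ofFn_injective (List.map_injective_iff.2 transCode_injective h)

theorem codeContains_eq {G : DBGraph} {l : ℕ} (s : G.Pattern l)
    (ts : Fin (l + 1) → Transaction G.numItems) :
    codeContains (graphCode G).1 (l + 1) (patternCode s) (seqCode ts) =
      decide (DBGraph.Contains ts s) := by
  have h1 : ∀ i : Fin (l + 1), (patternCode s).getD i [] = itemBits (s i) := fun i =>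
    getD_map_finRange _ i _
  have h2 : ∀ i : Fin (l + 1), (seqCode ts).getD i (0, []) = transCode (ts i) := fun i =>
    getD_map_finRange _ i _
  rw [Bool.eq_iff_iff, decide_eq_true_iff]
  simp only [codeContains, List.all_eq_true, List.mem_range, graphCode, List.mem_map,
    List.mem_finRange, true_and, forall_exists_index, forall_apply_eq_imp_iff]
  constructor
  · intro h i j hj
    have := h i i.2 j
    rw [h1, h2, itemBits_getD, transCode, itemBits_getD] at this
    simpa [hj] using this
  · intro h i hi j
    have e1 := h1 ⟨i, hi⟩
    have e2 := h2 ⟨i, hi⟩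
    simp only at e1 e2
    rw [e1, e2, itemBits_getD, transCode, itemBits_getD]
    have := @h ⟨i, hi⟩ j
    by_cases hj : j ∈ s ⟨i, hi⟩ <;> simp [hj]
    exact this hj

theorem graphCode_getD (G : DBGraph) (v : Fin G.numVertices) :
    (graphCode G).2.getD v ([], []) =
      ((List.finRange G.numVertices).map fun w => decide ((v, w) ∈ G.edges),
        (G.db v).map transCode) :=
  getD_map_finRange _ v _

theorem codeAdj_graphCode (G : DBGraph) (v w : Fin G.numVertices) :
    codeAdj (graphCode G).2 v w = decide ((v, w) ∈ G.edges) := by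
  rw [codeAdj, graphCode_getD]
  exact getD_map_finRange _ w _

/-- The entries of `labelledPaths` are the pairs of a simple path of `G` and a sequence of
transactions of its vertices. -/
theorem mem_labelledPaths (G : DBGraph) (k : ℕ) (x : List ℕ × List TransCode) :
    x ∈ labelledPaths (graphCode G).2 k ↔
      ∃ (vs : List (Fin G.numVertices)) (ts : List (Transaction G.numItems)),
        vs.length = k ∧ vs.Nodup ∧ vs.IsChain (fun v w => (v, w) ∈ G.edges) ∧
        List.Forall₂ (fun T v => T ∈ G.db v) ts vs ∧
        x = (vs.map Fin.val, ts.map transCode) := by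
  have hlen : (graphCode G).2.length = G.numVertices := by simp [graphCode]
  induction k generalizing x with
  | zero =>
    simp only [labelledPaths, List.mem_singleton]
    constructor
    · rintro rfl
      exact ⟨[], [], by simp⟩
    · rintro ⟨vs, ts, h1, -, -, h2, rfl⟩
      rw [List.length_eq_zero_iff] at h1
      subst h1
      cases h2
      rfl
  | succ k ih =>
    simp only [labelledPaths, List.mem_flatMap, ih, extendPath, hlen, List.mem_range]
    constructor
    · rintro ⟨_, ⟨vs, ts, h1, h2, h3, h4, rfl⟩, w, hw, h⟩
      split at h
      case isFalse => simp at h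
      case isTrue hc =>
        have hg := graphCode_getD G ⟨w, hw⟩
        simp only at hg
        rw [hg] at h
        simp only [List.map_map, List.mem_map, Function.comp_apply] at h
        obtain ⟨T, hT, rfl⟩ := h
        refine ⟨⟨w, hw⟩ :: vs, T :: ts, by simp [h1], ?_, ?_, .cons hT h4, rfl⟩
        · refine List.nodup_cons.2 ⟨fun hm => ?_, h2⟩
          simp only [Bool.and_eq_true, Bool.not_eq_true', decide_eq_false_iff_not] at hc
          exact hc.2 (List.mem_map.2 ⟨_, hm, rfl⟩)
        · cases vs with
          | nil => simp
          | cons v vs =>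
            have := codeAdj_graphCode G ⟨w, hw⟩ v
            simp only at this
            simp [this] at hc
            exact List.isChain_cons_cons.2 ⟨hc.1, h3⟩
    · rintro ⟨_ | ⟨w, vs⟩, ts, h1, h2, h3, h4, rfl⟩
      · simp at h1
      · obtain ⟨T, ts, hT, h5, rfl⟩ : ∃ T ts', T ∈ G.db w ∧
            List.Forall₂ (fun T v => T ∈ G.db v) ts' vs ∧ ts = T :: ts' := by
          cases h4 with | cons h h' => exact ⟨_, _, h, h', rfl⟩
        rw [List.nodup_cons] at h2
        refine ⟨_, ⟨vs, ts, by simpa using h1, h2.2, h3.tail, h5, rfl⟩, w, w.2, ?_⟩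
        rw [if_pos, graphCode_getD]
        · simpa using ⟨T.1, T.2, hT, rfl⟩
        · have hm : (w : ℕ) ∉ vs.map Fin.val := by
            simpa [Fin.val_inj] using h2.1
          cases vs with
          | nil => simp
          | cons v vs =>
            rw [List.isChain_cons_cons] at h3
            have := codeAdj_graphCode G w v
            simp only [decide_eq_true h3.1] at this
            simp only [List.map_cons, List.getD_cons_zero, this, Bool.or_true, Bool.true_and]
            simpa using hm

theorem codeSeqs_nodup_and_mem (V : List VertexCode) (k : ℕ) :
    (codeSeqs V k).Nodup ∧
      ∀ xs, xs ∈ codeSeqs V k ↔ ∃ x ∈ labelledPaths V k, x.2 = xs := by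
  have key : ∀ (L : List (List ℕ × List TransCode)) (b : List (List TransCode)), b.Nodup →
      (L.foldl (fun b x => if decide (x.2 ∈ b) then b else x.2 :: b) b).Nodup ∧
      ∀ xs, xs ∈ L.foldl (fun b x => if decide (x.2 ∈ b) then b else x.2 :: b) b ↔
        xs ∈ b ∨ ∃ x ∈ L, x.2 = xs := by
    intro L
    induction L with
    | nil => simp
    | cons x L ih =>
      intro b hb
      rw [List.foldl_cons]
      by_cases h : x.2 ∈ b
      · rw [if_pos (by simpa using h)]
        refine ⟨(ih b hb).1, fun xs => ((ih b hb).2 xs).trans ?_⟩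
        simp only [List.mem_cons, exists_eq_or_imp]
        constructor
        · rintro (h' | h')
          exacts [.inl h', .inr (.inr h')]
        · rintro (h' | rfl | h')
          exacts [.inl h', .inl h, .inr h']
      · rw [if_neg (by simpa using h)]
        have hb' := List.nodup_cons.2 ⟨h, hb⟩
        refine ⟨(ih _ hb').1, fun xs => ((ih _ hb').2 xs).trans ?_⟩
        simp only [List.mem_cons, exists_eq_or_imp]
        tauto
  have := key (labelledPaths V k) [] List.nodup_nil
  exact ⟨this.1, fun xs => (this.2 xs).trans (by simp)⟩

theorem toFinset_codeSeqs (G : DBGraph) (l : ℕ) :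
    (codeSeqs (graphCode G).2 (l + 1)).toFinset = (G.transSeqs l).image seqCode := by
  have hof : ∀ {α : Type} (L : List α), L.length = l + 1 →
      ∃ p : Fin (l + 1) → α, L = List.ofFn p := fun L hL =>
    ⟨fun i => L.get (i.cast hL.symm), List.ext_getElem (by simp only [hL, List.length_ofFn]) fun i _ _ => by
      simp only [List.getElem_ofFn, List.get_eq_getElem, Fin.val_cast]⟩
  ext xs
  rw [List.mem_toFinset, (codeSeqs_nodup_and_mem _ _).2, Finset.mem_image]
  simp only [mem_labelledPaths, DBGraph.transSeqs, DBGraph.paths, Finset.mem_biUnion,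
    Finset.mem_filter, Finset.mem_univ, true_and, Fintype.mem_piFinset, List.mem_toFinset]
  constructor
  · rintro ⟨_, ⟨vs, ts, h1, h2, h3, h4, rfl⟩, rfl⟩
    obtain ⟨ts, rfl⟩ := hof ts (h4.length_eq.trans h1)
    obtain ⟨p, rfl⟩ := hof vs h1
    refine ⟨ts, ⟨p, ⟨List.nodup_ofFn.1 h2, fun i => ?_⟩, fun i => ?_⟩, seqCode_eq_ofFn ts⟩
    · exact List.isChain_ofFn.1 h3 i (by omega)
    · have := (List.forall₂_iff_get.1 h4).2 i (by rw [List.length_ofFn]; exact i.2)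
        (by rw [List.length_ofFn]; exact i.2)
      simpa only [List.get_eq_getElem, List.getElem_ofFn] using this
  · rintro ⟨ts, ⟨p, ⟨h1, h2⟩, h3⟩, rfl⟩
    refine ⟨_, ⟨List.ofFn p, List.ofFn ts, List.length_ofFn, List.nodup_ofFn.2 h1,
      List.isChain_ofFn.2 fun i hi => h2 ⟨i, by omega⟩, List.forall₂_iff_get.2 ⟨?_, ?_⟩, rfl⟩,
      (seqCode_eq_ofFn ts).symm⟩
    · simp only [List.length_ofFn]
    · intro i hi _
      simp only [List.get_eq_getElem, List.getElem_ofFn]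
      exact h3 _

theorem length_codeSeqs (G : DBGraph) (l : ℕ) :
    (codeSeqs (graphCode G).2 (l + 1)).length = (G.transSeqs l).card := by
  rw [← List.toFinset_card_of_nodup (codeSeqs_nodup_and_mem _ _).1, toFinset_codeSeqs,
    Finset.card_image_of_injective _ seqCode_injective]

theorem length_filter_codeSeqs (G : DBGraph) {l : ℕ} (s : G.Pattern l) :
    ((codeSeqs (graphCode G).2 (l + 1)).filter
      (codeContains (graphCode G).1 (l + 1) (patternCode s))).length =
      ((G.transSeqs l).filter fun ts => DBGraph.Contains ts s).card := by
  rw [← List.toFinset_card_of_nodup ((codeSeqs_nodup_and_mem _ _).1.filter _), List.toFinset_filter,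
    toFinset_codeSeqs, Finset.filter_image, Finset.card_image_of_injective _ seqCode_injective]
  simp only [codeContains_eq, decide_eq_true_eq]

theorem codeExceeds_patternCode (G : DBGraph) {l : ℕ} (s : G.Pattern l) {α : ℚ} (hα : 0 < α) :
    codeExceeds (l + 1) (graphCode G, α.num.toNat, α.den) (patternCode s) =
      decide (α < G.freq s) := by
  rw [codeExceeds, length_codeSeqs, length_filter_codeSeqs, Bool.eq_iff_iff, decide_eq_true_iff (p := α < _)]
  have hne : patternCode s ≠ [] := by simp [patternCode]
  simp only [hne, decide_false, Bool.not_false, Bool.true_and, decide_eq_true_eq, DBGraph.freq]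
  have hden : (0 : ℚ) < α.den := by exact_mod_cast α.den_pos
  have hnum : ((α.num.toNat : ℕ) : ℚ) = α * α.den := by
    rw [Rat.mul_den_eq_num]
    exact_mod_cast Int.toNat_of_nonneg (Rat.num_pos.2 hα).le
  -- If `D_l` is empty, the frequency is `0` on both sides, below the positive threshold.
  rcases Nat.eq_zero_or_pos (G.transSeqs l).card with h0 | h0
  · have h1 : ((G.transSeqs l).filter fun ts => DBGraph.Contains ts s).card = 0 :=
      Nat.eq_zero_of_le_zero ((Finset.card_filter_le _ _).trans h0.le)
    simp [h0, h1, hα.le]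
  · rw [lt_div_iff₀ (by exact_mod_cast h0), ← Nat.cast_lt (α := ℚ)]
    push_cast
    rw [hnum, show α * α.den * ((G.transSeqs l).card : ℚ) =
      α.den * (α * (G.transSeqs l).card) by ring, mul_lt_mul_iff_right₀ hden]

theorem codeExceeds_nil (k : ℕ) (x : GraphCode × ℕ × ℕ) : codeExceeds k x [] = false := rfl

theorem codeBound_graphCode (G : DBGraph) (k a b : ℕ) :
    codeBound k (graphCode G, a, b) = 2 ^ (G.numItems * k) := by
  have : ∀ (L : List ℕ) (b : ℕ), L.foldl (fun b _ => b * 2 ^ k) b = b * 2 ^ (L.length * k) := by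
    intro L
    induction L with
    | nil => simp
    | cons a L ih =>
      intro b
      rw [List.foldl_cons, ih, List.length_cons]
      ring
  rw [codeBound, this]
  simp [graphCode]

/-! ### Sorted lists of patterns and the pattern count -/

theorem DBGraph.card_patterns_le (G : DBGraph) (allowEmpty : Bool) (l : ℕ) :
    (G.patterns allowEmpty l).card ≤ 2 ^ (G.numItems * (l + 1)) := by
  refine (Finset.card_filter_le _ _).trans ?_
  simp [pow_mul]

theorem DBGraph.patternCount_le (G : DBGraph) (allowEmpty : Bool) (l : ℕ) (α : ℚ) :
    G.patternCount allowEmpty l α ≤ 2 ^ (G.numItems * (l + 1)) :=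
  (Finset.card_filter_le _ _).trans (G.card_patterns_le allowEmpty l)

/-- In a list sorted by non-increasing values, the entries with values above a threshold form an
initial segment. -/
theorem lt_countP_iff_of_sorted {β : Type*} (f : β → ℚ) (α : ℚ) {L : List β}
    (hL : L.Pairwise fun s t => f t ≤ f s) (j : ℕ) :
    j < L.countP (fun s => decide (α < f s)) ↔ ∃ s, L[j]? = some s ∧ α < f s := by
  induction L generalizing j with
  | nil => simp
  | cons a L ih =>
    rw [List.pairwise_cons] at hL
    by_cases ha : α < f a
    · rw [List.countP_cons_of_pos (by simpa using ha)]
      cases j with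
      | zero => simp [ha]
      | succ j => simp [← ih hL.2]
    · have h0 : ∀ s ∈ a :: L, ¬ α < f s := by
        intro s hs h
        rcases List.mem_cons.1 hs with rfl | hs
        · exact ha h
        · exact ha (h.trans_le (hL.1 s hs))
      rw [List.countP_eq_zero.2 (by simpa using h0)]
      simp only [not_lt_zero, false_iff, not_exists, not_and]
      exact fun s hs => h0 s (List.mem_of_getElem? hs)

/-- If the list of the most frequent patterns is long enough to contain all of them, the pattern
count is the length of the initial segment of the patterns above the threshold. -/
theorem DBGraph.IsTopK.lt_patternCount_iff {G : DBGraph} {allowEmpty : Bool} {l K : ℕ}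
    {L : List (G.Pattern l)} (hL : G.IsTopK allowEmpty l K L)
    (hK : 2 ^ (G.numItems * (l + 1)) ≤ K) (α : ℚ) (j : ℕ) :
    j < G.patternCount allowEmpty l α ↔ ∃ s, L[j]? = some s ∧ α < G.freq s := by
  have hlen : L.length = (G.patterns allowEmpty l).card := by
    rw [hL.length_eq, min_eq_right ((G.card_patterns_le allowEmpty l).trans hK)]
  have hfin : L.toFinset = G.patterns allowEmpty l :=
    Finset.eq_of_subset_of_card_le (fun s hs => hL.subset s (List.mem_toFinset.1 hs))
      (by rw [List.toFinset_card_of_nodup hL.nodup, hlen])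
  have hcount : G.patternCount allowEmpty l α = L.countP (fun s => decide (α < G.freq s)) := by
    rw [patternCount, ← hfin, List.countP_eq_length_filter,
      ← List.toFinset_card_of_nodup (hL.nodup.filter _), List.toFinset_filter]
    simp only [decide_eq_true_eq]
  rw [hcount]
  exact lt_countP_iff_of_sorted _ α hL.sorted j

theorem DBGraph.IsTopK.eq_patternCount_iff {G : DBGraph} {allowEmpty : Bool} {l K : ℕ}
    {L : List (G.Pattern l)} (hL : G.IsTopK allowEmpty l K L)
    (hK : 2 ^ (G.numItems * (l + 1)) ≤ K) (α : ℚ) {k : ℕ} (hk : k ≤ L.length) :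
    k = G.patternCount allowEmpty l α ↔
      (0 < k → ∀ s, L[k - 1]? = some s → α < G.freq s) ∧
      (∀ s, L[k]? = some s → G.freq s ≤ α) := by
  have h := hL.lt_patternCount_iff hK α
  have h1 : (0 < k → ∀ s, L[k - 1]? = some s → α < G.freq s) ↔
      k ≤ G.patternCount allowEmpty l α := by
    rcases Nat.eq_zero_or_pos k with rfl | h0
    · simp
    · have hs : L[k - 1]? = some (L[k - 1]) := List.getElem?_eq_getElem (by omega)
      rw [show k ≤ G.patternCount allowEmpty l α ↔ k - 1 < G.patternCount allowEmpty l α by omega,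
        h, hs]
      simp [h0]
  have h2 : (∀ s, L[k]? = some s → G.freq s ≤ α) ↔ ¬ k < G.patternCount allowEmpty l α := by
    rw [h]
    simp
  rw [h1, h2]
  omega

/-! ### The reduction -/

/-- One round of the binary search. Variable `0` holds the instance, variable `1` the current step
`d`, and variable `2` a lower bound `k` of the pattern count; `test` decides in variable `4`
whether the frequency of the pattern that was read exceeds the threshold. -/
def searchRound (test : Cmd) : Cmd :=
  .seq (.read 3 (.sub (.add (.var 2) (.var 1)) (.const 1)))
    (.seq (.assign 4 (.pair (.var 0) (.var 3))) (.seq test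
      (.seq (.ite (.var 4) (.assign 2 (.add (.var 2) (.var 1))) .skip)
        (.assign 1 (.div (.var 1) (.const 2))))))

/-- One round of the binary search, with a bound `B` on the sizes of all the values in it. -/
theorem exec_searchRound {test : Cmd} {k : ℕ} {p : Polynomial ℕ}
    (htest : test.Computes 4
      (fun q : (GraphCode × ℕ × ℕ) × List (List Bool) => codeExceeds k q.1 q.2) p)
    (O : Val → List Val) (x : GraphCode × ℕ × ℕ) (ss : List (List (List Bool))) (σ : OState)
    (d c B : ℕ) (hx : σ.vars 0 = toVal x) (hd : σ.vars 1 = .nat d) (hc : σ.vars 2 = .nat c)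
    (hans : σ.answer = ss.map toVal) (hxB : csize x ≤ B) (hdB : d.size ≤ B) (hcB : c.size ≤ B)
    (hsB : ∀ s ∈ ss, csize s ≤ B) (hB : 1 ≤ B) :
    ∃ (σ' : OState) (t : ℕ), Exec O (searchRound test) σ σ' t 1 ∧
      σ'.vars 0 = toVal x ∧ σ'.vars 1 = .nat (d / 2) ∧
      σ'.vars 2 = .nat (if codeExceeds k x (ss.getD (c + d - 1) []) then c + d else c) ∧
      σ'.answer = ss.map toVal ∧ t ≤ p.eval (2 * B + 1) + 100 * B + 100 := by
  set s := ss.getD (c + d - 1) [] with hs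
  have hread : (ss.map toVal).getD (c + d - 1) (.nat 0) = toVal s := by
    rw [hs, ← toVal_nil (α := List Bool), List.getD_map]
  have hsz : csize s ≤ B := by
    rw [hs, List.getD_eq_getElem?_getD]
    rcases h : ss[c + d - 1]? with _ | s'
    · simpa [csize_nil] using hB
    · simpa using hsB s' (List.mem_of_getElem? h)
  have hadd := Nat.size_add_le c d
  have hsub : (c + d - 1).size ≤ (c + d).size := Nat.size_le_size (by omega)
  have hdiv : (d / 2).size ≤ d.size := Nat.size_le_size (Nat.div_le_self _ _)
  have E₁ := Exec.read (O := O) 3 (.sub (.add (.var 2) (.var 1)) (.const 1)) σ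
  have hev₁ : ((Expr.sub (.add (.var 2) (.var 1)) (.const 1)).eval σ.vars).toNat = c + d - 1 := by
    simp [Expr.eval, hd, hc, Val.toNat]
  rw [hev₁, hans, hread] at E₁
  have E₂ := Exec.assign (O := O) 4 (.pair (.var 0) (.var 3))
    ⟨Function.update σ.vars 3 (toVal s), ss.map toVal⟩
  have hev₂ : (Expr.pair (.var 0) (.var 3)).eval (Function.update σ.vars 3 (toVal s)) =
      toVal (x, s) := by simp [Expr.eval, hx, toVal_pair]
  simp only [hev₂] at E₂
  obtain ⟨σ₃, t₃, E₃, v₃, k₃, a₃, b₃⟩ := htest O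
    ⟨Function.update (Function.update σ.vars 3 (toVal s)) 4 (toVal (x, s)), ss.map toVal⟩ (x, s)
    (by simp)
  have v0 : σ₃.vars 0 = toVal x := by rw [k₃ 0 (by norm_num)]; simp [hx]
  have v1 : σ₃.vars 1 = .nat d := by rw [k₃ 1 (by norm_num)]; simp [hd]
  have v2 : σ₃.vars 2 = .nat c := by rw [k₃ 2 (by norm_num)]; simp [hc]
  have ht₃ : t₃ ≤ p.eval (2 * B + 1) := b₃.trans (p.eval_mono_nat (by rw [csize_pair]; omega))
  have hbool : (toVal (codeExceeds k x s)).size ≤ 2 := csize_bool_le _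
  obtain ⟨t₄, E₄, b₄⟩ : ∃ t₄, Exec O
      (.ite (.var 4) (.assign 2 (.add (.var 2) (.var 1))) .skip) σ₃
      ⟨Function.update σ₃.vars 2 (.nat (if codeExceeds k x s then c + d else c)), σ₃.answer⟩ t₄ 0 ∧
      t₄ ≤ 10 * B + 20 := by
    have hadd' : (Expr.add (.var 2) (.var 1)).eval σ₃.vars = .nat (c + d) := by
      simp [Expr.eval, v1, v2, Val.toNat]
    cases hb : codeExceeds k x s with
    | true =>
      have E := Exec.assign (O := O) 2 (.add (.var 2) (.var 1)) σ₃
      rw [hadd'] at E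
      refine ⟨_, Exec.ite_true ?_ E, ?_⟩
      · simp [Expr.eval, v₃, hb, toVal_bool, Val.ofBool]
      · simp [Expr.eval, Expr.cost, v₃, v1, v2, Val.toNat, Val.size]
        omega
    | false =>
      have E : Exec O .skip σ₃ ⟨Function.update σ₃.vars 2 (.nat c), σ₃.answer⟩ 1 0 := by
        rw [← v2, Function.update_eq_self]
        exact Exec.skip σ₃
      refine ⟨_, Exec.ite_false ?_ E, ?_⟩
      · simp [Expr.eval, v₃, hb, toVal_bool, Val.ofBool]
      · simp [Expr.cost, v₃]
        omega
  have E := E₁.seq (E₂.seq_free (E₃.seq_free (E₄.seq_free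
    (Exec.assign (O := O) 1 (.div (.var 1) (.const 2)) _))))
  refine ⟨_, _, E, by simp [v0], by simp [Expr.eval, v1, Val.toNat], by simp, a₃, ?_⟩
  have hsz2 : (2 : ℕ).size = 2 := by decide
  have hsz1 : (1 : ℕ).size = 1 := by decide
  simp [Expr.eval, Expr.cost, hx, hd, hc, v1, Val.toNat, Val.size, toVal_pair, hsz2, hsz1,
    csize] at *
  omega

/-- The binary search: if the entries of the answer that pass the test are the first `c` ones, it
finds `c`. Initially `c < k + 2 ^ (N + 1)` for the lower bound `k` and the step `2 ^ N`; every round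
halves the range. -/
theorem exec_search {test : Cmd} {k : ℕ} {p : Polynomial ℕ}
    (htest : test.Computes 4
      (fun q : (GraphCode × ℕ × ℕ) × List (List Bool) => codeExceeds k q.1 q.2) p)
    (O : Val → List Val) (x : GraphCode × ℕ × ℕ) (ss : List (List (List Bool))) (c B : ℕ)
    (hss : ∀ j, codeExceeds k x (ss.getD j []) = true ↔ j < c) (hxB : csize x ≤ B)
    (hcB : c.size ≤ B) (hsB : ∀ s ∈ ss, csize s ≤ B) (N : ℕ) (hNB : N + 1 ≤ B) (b : ℕ) (σ : OState)
    (hx : σ.vars 0 = toVal x) (hd : σ.vars 1 = .nat (2 ^ N)) (hb : σ.vars 2 = .nat b)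
    (hans : σ.answer = ss.map toVal) (hbc : b ≤ c) (hcb : c < b + 2 ^ (N + 1)) :
    ∃ (σ' : OState) (t : ℕ), Exec O (.loop (.var 1) (searchRound test)) σ σ' t (N + 1) ∧
      σ'.vars 2 = .nat c ∧ t ≤ (N + 2) * (p.eval (2 * B + 1) + 110 * B + 110) := by
  have hdsize : ((2 : ℕ) ^ N).size ≤ B := by rw [Nat.size_pow]; exact hNB
  obtain ⟨σ₁, t₁, e₁, v0, v1, v2, a₁, b₁⟩ := exec_searchRound htest O x ss σ (2 ^ N) b B hx hd hb
    hans hxB hdsize ((Nat.size_le_size hbc).trans hcB) hsB (by omega)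
  have hpos : 0 < 2 ^ N := Nat.two_pow_pos N
  have hguard : (Expr.var 1).eval σ.vars ≠ .nat 0 := by simp [Expr.eval, hd]
  have htest' := hss (b + 2 ^ N - 1)
  rw [pow_succ] at hcb
  obtain ⟨b', hb', hbc', hcb'⟩ : ∃ b', (if codeExceeds k x (ss.getD (b + 2 ^ N - 1) []) then
      b + 2 ^ N else b) = b' ∧ b' ≤ c ∧ c < b' + 2 ^ N := by
    refine ⟨_, rfl, ?_⟩
    split_ifs with h
    · have := htest'.1 h
      omega
    · have := mt htest'.2 h
      omega
  rw [hb'] at v2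
  have hcost : (Expr.var 1).cost σ.vars ≤ B + 1 := by
    simp only [Expr.cost, hd, Val.size]
    omega
  cases N with
  | zero =>
    have E := Exec.loop_true hguard e₁ (Exec.loop_false (by simp [Expr.eval, v1]))
    refine ⟨σ₁, _, E, ?_, ?_⟩
    · rw [v2, show b' = c by omega]
    · have : (Expr.var 1).cost σ₁.vars = 1 := by simp [Expr.cost, v1, Val.size]
      omega
  | succ N =>
    obtain ⟨σ₂, t₂, e₂, w₂, b₂⟩ := exec_search htest O x ss c B hss hxB hcB hsB N (by omega) b' σ₁
      v0 (by rw [v1, pow_succ, Nat.mul_div_cancel _ (by norm_num)]) v2 a₁ hbc' hcb'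
    refine ⟨σ₂, _, by simpa [add_comm] using Exec.loop_true hguard e₁ e₂, w₂, ?_⟩
    have h1 : (N + 1 + 2) * (p.eval (2 * B + 1) + 110 * B + 110) =
      (N + 2) * (p.eval (2 * B + 1) + 110 * B + 110) + (p.eval (2 * B + 1) + 110 * B + 110) := by
      ring
    omega

theorem csize_patternCode_le {G : DBGraph} {l : ℕ} (s : G.Pattern l) :
    csize (patternCode s) ≤ (l + 1) * (G.numItems * 3 + 2) + 1 := by
  have h := csize_list_le (L := patternCode s) (B := G.numItems * 3 + 1) fun a ha => by
    obtain ⟨i, -, rfl⟩ := List.mem_map.1 ha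
    have := csize_list_le (L := itemBits (s i)) (B := 2) fun b _ => csize_bool_le b
    simpa [itemBits] using this
  simpa [patternCode] using h

/-- The reduction: it asks once for all the patterns and finds the pattern count by binary search in
the answer. -/
theorem cookReducible_SPCG_TSPMG (allowEmpty : Bool) (l : ℕ) :
    CookReducible (SPCG allowEmpty l) (TSPMG allowEmpty l)
      (fun x => 2 * (x.1.numItems * (l + 1) + 1)) := by
  obtain ⟨pb, hpb, cb⟩ := PolyTime.codeBound (l + 1)
  obtain ⟨pt, -, ct⟩ := PolyTime.codeExceeds (l + 1)
  obtain ⟨bound, hbound⟩ := cb 1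
  obtain ⟨test, htest⟩ := ct 4
  -- A bound for the sizes of the instance, of the numbers in the search, and of all pattern codes.
  let B : Polynomial ℕ := (Polynomial.X + 1) * ((4 * (l + 1) : ℕ) : Polynomial ℕ) + 10
  refine ⟨.seq (.assign 1 (.var 0)) (.seq bound (.seq (.query (.pair (.fst (.var 0)) (.var 1)))
    (.seq (.assign 2 (.const 0)) (.seq (.loop (.var 1) (searchRound test))
      (.assign 0 (.pair (.var 2) (.const 0))))))),
    pb + 100 * B + 100 + (B + 2) * (pt.comp (2 * B + 1) + 110 * B + 110), ?_⟩
  rintro O hO ⟨G, α, hα⟩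
  set x : GraphCode × ℕ × ℕ := (graphCode G, α.num.toNat, α.den) with hx
  have hcode : (SPCG allowEmpty l).code (G, ⟨α, hα⟩) = toVal x := by
    rw [hx, toVal_pair, toVal_graphCode]
    rfl
  rw [hcode]
  set N := G.numItems * (l + 1) with hN
  obtain ⟨L, hL, hans⟩ := hO (G, ⟨2 ^ N, Nat.two_pow_pos N⟩)
  have hquery : (TSPMG allowEmpty l).code (G, ⟨2 ^ N, Nat.two_pow_pos N⟩) =
      .pair (toVal (graphCode G)) (.nat (2 ^ N)) := by
    rw [toVal_graphCode]
    rfl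
  rw [hquery] at hans
  have hans' : O (.pair (toVal (graphCode G)) (.nat (2 ^ N))) =
      (L.map patternCode).map toVal := by
    rw [hans, List.map_map]
    exact List.map_congr_left fun s _ => (toVal_patternCode s).symm
  have hcB : B.eval (csize x) = (csize x + 1) * (4 * (l + 1)) + 10 := by simp [B]
  have hmx : G.numItems ≤ csize x := by
    have h1 := length_lt_csize (graphCode G).1
    have h2 : csize x = csize (graphCode G).1 + csize (graphCode G).2 + 1 +
      csize (α.num.toNat, α.den) + 1 := rfl
    have h3 : (graphCode G).1.length = G.numItems := by simp [graphCode]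
    omega
  have hmB : (G.numItems + 1) * (4 * (l + 1)) + 10 ≤ B.eval (csize x) := by
    rw [hcB]
    gcongr
  have hxB : csize x ≤ B.eval (csize x) := by
    rw [hcB]
    nlinarith
  obtain ⟨σ₁, t₁, e₁, v1, k₁, a₁, b₁⟩ := hbound O
    ⟨Function.update (OState.init (toVal x)).vars 1 (toVal x), []⟩ x (by simp)
  rw [hx, codeBound_graphCode, ← hN, toVal_nat] at v1
  have v0 : σ₁.vars 0 = toVal x := by
    rw [k₁ 0 (by norm_num)]
    simp [OState.init]
  have hev : (Expr.pair (.fst (.var 0)) (.var 1)).eval σ₁.vars =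
      .pair (toVal (graphCode G)) (.nat (2 ^ N)) := by
    simp [Expr.eval, v0, v1, hx, toVal_pair, Val.fst]
  have E₂ := Exec.query (O := O) (.pair (.fst (.var 0)) (.var 1)) σ₁
  rw [hev, hans'] at E₂
  set c := G.patternCount allowEmpty l α with hc
  have hcN : c ≤ 2 ^ N := G.patternCount_le allowEmpty l α
  have hNB : N + 1 ≤ B.eval (csize x) := by
    rw [hN]
    nlinarith
  obtain ⟨σ₃, t₃, e₃, w₃, b₃⟩ := exec_search htest O x (L.map patternCode) c (B.eval (csize x))
    (fun j => by
      rw [hL.lt_patternCount_iff le_rfl α j]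
      rw [List.getD_eq_getElem?_getD, List.getElem?_map]
      rcases L[j]? with _ | s
      · simp [codeExceeds_nil]
      · simp [hx, codeExceeds_patternCode G s hα])
    hxB ((Nat.size_le_size hcN).trans (by rw [Nat.size_pow]; exact hNB))
    (fun s hs => by
      obtain ⟨s, -, rfl⟩ := List.mem_map.1 hs
      refine (csize_patternCode_le s).trans (le_trans ?_ hmB)
      nlinarith)
    N hNB 0 ⟨Function.update σ₁.vars 2 (.nat 0), (L.map patternCode).map toVal⟩
    (by simp [v0]) (by simp [v1]) (by simp) rfl (Nat.zero_le _)
    (by rw [pow_succ]; have := Nat.two_pow_pos N; omega)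
  have E₁ := Exec.assign (O := O) 1 (.var 0) (OState.init (toVal x))
  have hev₁ : (Expr.var 0).eval (OState.init (toVal x)).vars = toVal x := by
    simp [Expr.eval, OState.init]
  rw [hev₁] at E₁
  have E := E₁.seq_free (e₁.seq_free (E₂.seq ((Exec.assign (O := O) 2 (.const 0) _).seq_free
    (e₃.seq (Exec.assign (O := O) 0 (.pair (.var 2) (.const 0)) _)))))
  refine ⟨_, _, _, [.nat c], E, ?_, ?_, rfl, by simp [Expr.eval, w₃, Val.ofList]⟩
  · have h1 : t₃ ≤ (B.eval (csize x) + 2) *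
        (pt.eval (2 * B.eval (csize x) + 1) + 110 * B.eval (csize x) + 110) :=
      b₃.trans (Nat.mul_le_mul_right _ (by omega))
    have h2 : c.size ≤ N + 1 := (Nat.size_le_size hcN).trans Nat.size_pow.le
    have h3 : csize x = (toVal x).size := rfl
    have h4 : (toVal x).size = (toVal (graphCode G)).size +
      (toVal (α.num.toNat, α.den)).size + 1 := rfl
    have h5 : ((2 : ℕ) ^ N).size = N + 1 := Nat.size_pow
    have h6 : ((0 : ℕ)).size = 0 := rfl
    have h7 : (Expr.var 0).cost (OState.init (toVal x)).vars = (toVal x).size := by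
      simp [Expr.cost, OState.init]
    have h8 : (Expr.pair (.fst (.var 0)) (.var 1)).cost σ₁.vars ≤ 10 * B.eval (csize x) + 10 := by
      have h9 : (toVal x).fst = toVal (graphCode G) := rfl
      simp only [Expr.cost, Expr.eval, v0, v1, h9, Val.size, h5]
      omega
    have h10 : (Expr.pair (.var 2) (.const 0)).cost σ₃.vars ≤ 10 * B.eval (csize x) + 10 := by
      simp only [Expr.cost, Expr.eval, w₃, Val.size, h6]
      omega
    have h11 : ∀ ρ, (Expr.const 0).cost ρ = 1 := fun ρ => rfl
    rw [h11, h7, ← h3]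
    simp only [Polynomial.eval_add, Polynomial.eval_mul, Polynomial.eval_comp, Polynomial.eval_one,
      Polynomial.eval_ofNat]
    change _ ≤ pb.eval (csize x) + 100 * B.eval (csize x) + 100 + (B.eval (csize x) + 2) *
        (pt.eval (2 * B.eval (csize x) + 1) + 110 * B.eval (csize x) + 110)
    omega
  · -- The accesses are the question and `N + 1` reads.
    simp only [← hN]
    omega

theorem theorem2 :
    ∃ C : ℕ, ∀ (allowEmpty : Bool) (l : ℕ), 0 < l →
      CookReducible (SPCG allowEmpty l) (TSPMG allowEmpty l)
        (fun x => C * (x.1.numItems * (l + 1) + 1)) ∧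
      ∀ (G : DBGraph) (α : ℚ), 0 < α →
        G.patternCount allowEmpty l α ≤ 2 ^ (G.numItems * (l + 1)) ∧
        ∀ (K : ℕ) (L : List (G.Pattern l)), 2 ^ (G.numItems * (l + 1)) ≤ K →
          G.IsTopK allowEmpty l K L → ∀ k ≤ L.length,
            (k = G.patternCount allowEmpty l α ↔
              (0 < k → ∀ s, L[k - 1]? = some s → α < G.freq s) ∧
              (∀ s, L[k]? = some s → G.freq s ≤ α)) := by
  exact ⟨2, fun allowEmpty l _ => ⟨cookReducible_SPCG_TSPMG allowEmpty l, fun G α _ =>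
    ⟨G.patternCount_le allowEmpty l α, fun _ _ hK hL _ hk => hL.eq_patternCount_iff hK α hk⟩⟩⟩
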